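/- Let $\mathcal H_A,\mathcal H_B,\mathcal H_E$ be separable complex Hilbert spaces, let $\mathcal N:\mathcal T(\mathcal H_A)\to\mathcal T(\mathcal H_B)$ be a quantum channel (a completely positive trace-preserving linear map between the spaces of trace-class operators), and let $\hat{\mathcal N}:\mathcal T(\mathcal H_A)\to\mathcal T(\mathcal H_E)$ be a channel complementary to $\mathcal N$: there is an isometry $U:\mathcal H_A\to\mathcal H_B\otimes\mathcal H_E$ with $\mathcal N(\tau)=\operatorname{Tr}_E\{U\tau U^\dagger\}$ and $\hat{\mathcal N}(\tau)=\operatorname{Tr}_B\{U\tau U^\dagger\}$ for all $\tau$. Let $G=\sum_j g_j|e_j\rangle\langle e_j|$ be an energy observable on $\mathcal H_A$, where $\{|e_j\rangle\}_j$ is an orthonormal basis and $g_j\ge 0$, and let $\overline G_n=\frac1n\left(G\otimes I\otimes\cdots\otimes I+\cdots+I\otimes\cdots\otimes I\otimes G\right)$ on $\mathcal H_A^{\otimes n}$. The energy of a state is $\operatorname{Tr}\{G\rho\}:=\sup_k\operatorname{Tr}\{\Pi_kG\Pi_k\rho\}\in[0,\infty]$, where $\Pi_k$ is the spectral projection of $G$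 for $[0,k]$, and likewise for $\overline G_n$. Write $F(\rho,\sigma)=\|\sqrt\rho\sqrt\sigma\|_1^2$ and $\|A\|_1=\operatorname{Tr}|A|$, and let $\mathcal D(\cdot)$ denote the set of density operators. An $(n,M,G,P,\varepsilon)$ code for quantum communication over $\mathcal N$ with uniform energy constraint consists of channels $\mathcal E^n:\mathcal T(\mathcal H_S)\to\mathcal T(\mathcal H_A^{\otimes n})$ and $\mathcal D^n:\mathcal T(\mathcal H_B^{\otimes n})\to\mathcal T(\mathcal H_S)$ with $\dim\mathcal H_S=M$ such that $\operatorname{Tr}\{\overline G_n\mathcal E^n(\rho)\}\le P$ for every $\rho\in\mathcal D(\mathcal H_S)$, and $F(\phi_{RS},(\operatorname{id}_R\otimes[\mathcal D^n\circ\mathcal N^{\otimes n}\circ\mathcal E^n])(\phi_{RS}))\ge 1-\varepsilon$ for every pure state $\phi_{RS}$ on $\mathcal H_R\otimes\mathcal H_S$, where $\mathcal H_R\cong\mathcal H_S$. An $(n,M,G,P,\varepsilon)$ code for private communication over $\mathcal N$ with uniform energy constraint consists of states $\rho^1,\dots,\rho^M\in\mathcal D(\mathcal H_A^{\otimes n})$,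 a POVM $\{\Lambda^m\}_{m=1}^M$ on $\mathcal H_B^{\otimes n}$ (that is, $\Lambda^m\ge0$ and $\sum_m\Lambda^m=I$) and a state $\omega\in\mathcal D(\mathcal H_E^{\otimes n})$ such that, for all $m\in\{1,\dots,M\}$, $\operatorname{Tr}\{\overline G_n\rho^m\}\le P$, $\operatorname{Tr}\{\Lambda^m\mathcal N^{\otimes n}(\rho^m)\}\ge1-\varepsilon$, and $\frac12\|\hat{\mathcal N}^{\otimes n}(\rho^m)-\omega\|_1\le\varepsilon$. Theorem. Let $n\ge1$ and $M\ge2$ be integers, $P\ge0$ and $\varepsilon\in[0,1]$. If there exists an $(n,M,G,P,\varepsilon)$ code for quantum communication over $\mathcal N$ with uniform energy constraint, then there exists an $(n,\lfloor M/2\rfloor,G,P,2\sqrt\varepsilon)$ code for private communication over $\mathcal N$ with uniform energy constraint. -/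

import Mathlib

open scoped ENNReal TensorProduct InnerProductSpace ComplexOrder

noncomputable section

namespace QInfo

section TraceClass

variable {H K : Type*}
  [NormedAddCommGroup H] [InnerProductSpace ℂ H] [CompleteSpace H]
  [NormedAddCommGroup K] [InnerProductSpace ℂ K] [CompleteSpace K]

/-- The index set of a fixed orthonormal (Hilbert) basis of `H`. -/
def basisIndex (H : Type*) [NormedAddCommGroup H] [InnerProductSpace ℂ H] [CompleteSpace H] :
    Set H :=
  (exists_hilbertBasis ℂ H).choose

/-- A fixed orthonormal (Hilbert) basis of `H`, used to evaluate traces. -/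
def onb (H : Type*) [NormedAddCommGroup H] [InnerProductSpace ℂ H] [CompleteSpace H] :
    HilbertBasis (basisIndex H) ℂ H :=
  (exists_hilbertBasis ℂ H).choose_spec.choose

/-- The trace `Tr A = ∑ᵢ ⟨eᵢ, A eᵢ⟩` (absolutely convergent and independent of the orthonormal
basis whenever `A` is trace class). -/
def trace (A : H →L[ℂ] H) : ℂ := ∑' i, ⟪onb H i, A (onb H i)⟫_ℂ

/-- The trace norm `‖A‖₁ = Tr |A|` with `|A| = √(A† A)`, as an extended non-negative real. -/
def traceNorm (A : H →L[ℂ] H) : ℝ≥0∞ :=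
  ∑' i, ENNReal.ofReal (⟪onb H i, CFC.abs A (onb H i)⟫_ℂ).re

theorem tsum_sq_inner_le {H : Type*} [NormedAddCommGroup H] [InnerProductSpace ℂ H]
    {κ : Type*} {e : κ → H} (he : Orthonormal ℂ e) (x : H) :
    ∑' i, ENNReal.ofReal (‖⟪e i, x⟫_ℂ‖ ^ 2) ≤ ENNReal.ofReal (‖x‖ ^ 2) := by
  rw [← ENNReal.ofReal_tsum_of_nonneg (fun _ => by positivity) (he.inner_products_summable x)]
  exact ENNReal.ofReal_le_ofReal (he.tsum_inner_products_le x)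

theorem tsum_sq_inner_eq {H : Type*} [NormedAddCommGroup H] [InnerProductSpace ℂ H]
    {κ : Type*} (b : HilbertBasis κ ℂ H) (x : H) :
    ∑' i, ENNReal.ofReal (‖⟪b i, x⟫_ℂ‖ ^ 2) = ENNReal.ofReal (‖x‖ ^ 2) := by
  rw [← ENNReal.ofReal_tsum_of_nonneg (fun _ => by positivity)
    (b.orthonormal.inner_products_summable x)]
  congr 1
  have h := b.tsum_inner_mul_inner x x
  have h2 : ∀ i, ⟪x, b i⟫_ℂ * ⟪b i, x⟫_ℂ = ((‖⟪b i, x⟫_ℂ‖ ^ 2 : ℝ) : ℂ) := by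
    intro i
    rw [← inner_conj_symm x (b i), ← Complex.normSq_eq_norm_sq, Complex.normSq_eq_conj_mul_self]
  simp_rw [h2] at h
  rw [← Complex.ofReal_tsum, inner_self_eq_norm_sq_to_K] at h
  refine Complex.ofReal_injective (h.trans ?_)
  push_cast
  rfl

theorem tsum_sq_norm_comp_le {κ : Type*} {e : κ → K} (he : Orthonormal ℂ e)
    (T : H →L[ℂ] H) (hT : ContinuousLinearMap.adjoint T = T) (V : K →L[ℂ] H) :
    ∑' i, ENNReal.ofReal (‖T (V (e i))‖ ^ 2) ≤
      ENNReal.ofReal (‖V‖ ^ 2) * ∑' j, ENNReal.ofReal (‖T (onb H j)‖ ^ 2) := by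
  have hsw : ∀ i j, ‖⟪onb H j, T (V (e i))⟫_ℂ‖ =
      ‖⟪e i, ContinuousLinearMap.adjoint V (T (onb H j))⟫_ℂ‖ := by
    intro i j
    rw [← ContinuousLinearMap.adjoint_inner_left, hT, ContinuousLinearMap.adjoint_inner_right,
      norm_inner_symm]
  calc ∑' i, ENNReal.ofReal (‖T (V (e i))‖ ^ 2)
      = ∑' i, ∑' j, ENNReal.ofReal
          (‖⟪e i, ContinuousLinearMap.adjoint V (T (onb H j))⟫_ℂ‖ ^ 2) := by
        refine tsum_congr fun i => ?_
        rw [← tsum_sq_inner_eq (onb H)]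
        simp_rw [hsw]
    _ = ∑' j, ∑' i, ENNReal.ofReal
          (‖⟪e i, ContinuousLinearMap.adjoint V (T (onb H j))⟫_ℂ‖ ^ 2) := ENNReal.tsum_comm
    _ ≤ ∑' j, ENNReal.ofReal (‖V‖ ^ 2) * ENNReal.ofReal (‖T (onb H j)‖ ^ 2) := by
        refine ENNReal.tsum_le_tsum fun j => (tsum_sq_inner_le he _).trans ?_
        rw [← ENNReal.ofReal_mul (by positivity), ← mul_pow]
        refine ENNReal.ofReal_le_ofReal (pow_le_pow_left₀ (norm_nonneg _) ?_ 2)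
        refine (ContinuousLinearMap.le_opNorm _ _).trans ?_
        simp
    _ = _ := ENNReal.tsum_mul_left

theorem norm_abs_apply (A : H →L[ℂ] H) (x : H) : ‖CFC.abs A x‖ = ‖A x‖ := by
  have hsa : IsSelfAdjoint (CFC.abs A) := IsSelfAdjoint.of_nonneg (CFC.abs_nonneg A)
  have h : ⟪CFC.abs A x, CFC.abs A x⟫_ℂ = ⟪A x, A x⟫_ℂ := by
    rw [← ContinuousLinearMap.adjoint_inner_right, ← ContinuousLinearMap.adjoint_inner_right,
      hsa.adjoint_eq]
    exact congrArg (fun T : H →L[ℂ] H => ⟪x, T x⟫_ℂ) (CFC.abs_mul_abs A)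
  rw [inner_self_eq_norm_sq_to_K, inner_self_eq_norm_sq_to_K] at h
  exact (pow_left_inj₀ (norm_nonneg _) (norm_nonneg _) two_ne_zero).1 (by exact_mod_cast h)

/-- Polar decomposition `A = W |A|`, `|A| = W† A`. -/
theorem exists_polar (A : H →L[ℂ] H) : ∃ W : H →L[ℂ] H,
    W ∘L CFC.abs A = A ∧ ContinuousLinearMap.adjoint W ∘L A = CFC.abs A := by
  set Q := CFC.abs A with hQ
  let S : Submodule ℂ H := Q.range.topologicalClosure
  have : CompleteSpace S := Submodule.isClosed_topologicalClosure _ |>.completeSpace_coe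
  have hmem : ∀ x, Q x ∈ S := fun x => Submodule.le_topologicalClosure _ ⟨x, rfl⟩
  let e : H →ₗ[ℂ] S := (Q : H →ₗ[ℂ] H).codRestrict S hmem
  have hd : DenseRange e := by
    intro y
    rw [Metric.mem_closure_range_iff]
    intro ε hε
    have hy : (y : H) ∈ closure (Set.range Q) := y.2
    obtain ⟨x, hx⟩ := Metric.mem_closure_range_iff.1 hy ε hε
    exact ⟨x, hx⟩
  have hn : ∀ x, ‖(A : H →ₗ[ℂ] H) x‖ ≤ 1 * ‖e x‖ := fun x => by
    rw [one_mul]; exact (norm_abs_apply A x).symm.le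
  let W₀ : S →L[ℂ] H := (A : H →ₗ[ℂ] H).extendOfNorm e
  let W : H →L[ℂ] H := W₀ ∘L S.orthogonalProjectionOnto
  have hW : ∀ x, W (Q x) = A x := by
    intro x
    have : S.orthogonalProjectionOnto (Q x) = e x :=
      Submodule.orthogonalProjectionOnto_mem_subspace_eq_self (K := S) (e x)
    change W₀ (S.orthogonalProjectionOnto (Q x)) = A x
    rw [this]
    exact LinearMap.extendOfNorm_eq hd ⟨1, hn⟩ x
  have hle : ∀ z, ‖W z‖ ≤ ‖z‖ := by
    intro z
    refine (LinearMap.norm_extendOfNorm_apply_le hd 1 hn _).trans ?_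
    rw [one_mul]
    exact Submodule.norm_orthogonalProjectionOnto_apply_le S z
  have hW1 : ‖W‖ ≤ 1 := W.opNorm_le_bound zero_le_one (by simpa using hle)
  refine ⟨W, ContinuousLinearMap.ext hW, ContinuousLinearMap.ext fun x => ?_⟩
  change ContinuousLinearMap.adjoint W (A x) = Q x
  rw [← sub_eq_zero, ← norm_eq_zero]
  have h1 : ‖ContinuousLinearMap.adjoint W (A x)‖ ≤ ‖A x‖ := by
    refine (ContinuousLinearMap.le_opNorm _ _).trans ?_
    have : ‖ContinuousLinearMap.adjoint W‖ ≤ 1 := by simpa using hW1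
    exact mul_le_of_le_one_left (norm_nonneg _) this
  have h2 : RCLike.re ⟪ContinuousLinearMap.adjoint W (A x), Q x⟫_ℂ = ‖A x‖ ^ 2 := by
    rw [ContinuousLinearMap.adjoint_inner_left, hW, inner_self_eq_norm_sq]
  have h3 := norm_sub_sq (𝕜 := ℂ) (ContinuousLinearMap.adjoint W (A x)) (Q x)
  rw [h2, norm_abs_apply] at h3
  have h4 : ‖ContinuousLinearMap.adjoint W (A x)‖ ^ 2 ≤ ‖A x‖ ^ 2 :=
    pow_le_pow_left₀ (norm_nonneg _) h1 2
  nlinarith [sq_nonneg ‖ContinuousLinearMap.adjoint W (A x) - Q x‖]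

theorem tsum_norm_inner_lt_top {A : H →L[ℂ] H} (hA : traceNorm A < ∞) {κ : Type*} {e : κ → K}
    (he : Orthonormal ℂ e) (U V : K →L[ℂ] H) :
    ∑' i, ENNReal.ofReal ‖⟪U (e i), A (V (e i))⟫_ℂ‖ < ∞ := by
  obtain ⟨W, hW, -⟩ := exists_polar A
  set T := CFC.sqrt (CFC.abs A) with hT
  have hTsa : ContinuousLinearMap.adjoint T = T :=
    (IsSelfAdjoint.of_nonneg (CFC.sqrt_nonneg (CFC.abs A))).adjoint_eq
  have hTT : ∀ x, T (T x) = CFC.abs A x := fun x =>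
    congrArg (fun S : H →L[ℂ] H => S x) (CFC.sqrt_mul_sqrt_self (CFC.abs A) (CFC.abs_nonneg A))
  have hfin : ∑' j, ENNReal.ofReal (‖T (onb H j)‖ ^ 2) < ∞ := by
    refine lt_of_eq_of_lt (tsum_congr fun j => ?_) hA
    rw [← hTT, ← hTsa, ContinuousLinearMap.adjoint_inner_right, hTsa]
    congr 1
    exact (inner_self_eq_norm_sq (𝕜 := ℂ) _).symm
  have hb : ∀ i, ENNReal.ofReal ‖⟪U (e i), A (V (e i))⟫_ℂ‖ ≤
      ENNReal.ofReal (‖T ((ContinuousLinearMap.adjoint W ∘L U) (e i))‖ ^ 2) +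
        ENNReal.ofReal (‖T (V (e i))‖ ^ 2) := by
    intro i
    rw [← ENNReal.ofReal_add (by positivity) (by positivity)]
    refine ENNReal.ofReal_le_ofReal ?_
    have h1 : ⟪U (e i), A (V (e i))⟫_ℂ =
        ⟪T ((ContinuousLinearMap.adjoint W ∘L U) (e i)), T (V (e i))⟫_ℂ := by
      rw [← ContinuousLinearMap.adjoint_inner_right T, hTsa, hTT, ContinuousLinearMap.comp_apply,
        ContinuousLinearMap.adjoint_inner_left]
      exact congrArg (fun S : H →L[ℂ] H => ⟪U (e i), S (V (e i))⟫_ℂ) hW.symm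
    rw [h1]
    refine (norm_inner_le_norm _ _).trans ?_
    nlinarith [sq_nonneg (‖T ((ContinuousLinearMap.adjoint W ∘L U) (e i))‖ - ‖T (V (e i))‖),
      sq_nonneg (‖T ((ContinuousLinearMap.adjoint W ∘L U) (e i))‖ + ‖T (V (e i))‖)]
  refine (ENNReal.tsum_le_tsum hb).trans_lt ?_
  rw [ENNReal.tsum_add]
  exact ENNReal.add_lt_top.2
    ⟨(tsum_sq_norm_comp_le he T hTsa _).trans_lt (ENNReal.mul_lt_top ENNReal.ofReal_lt_top hfin),
      (tsum_sq_norm_comp_le he T hTsa _).trans_lt (ENNReal.mul_lt_top ENNReal.ofReal_lt_top hfin)⟩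

theorem traceNorm_lt_top_of_tsum {A : H →L[ℂ] H}
    (h : ∀ U : H →L[ℂ] H, ∑' i, ENNReal.ofReal ‖⟪U (onb H i), A (onb H i)⟫_ℂ‖ < ∞) :
    traceNorm A < ∞ := by
  obtain ⟨W, -, hW⟩ := exists_polar A
  refine lt_of_le_of_lt (ENNReal.tsum_le_tsum fun i => ENNReal.ofReal_le_ofReal ?_) (h W)
  rw [← hW, ContinuousLinearMap.comp_apply, ContinuousLinearMap.adjoint_inner_right]
  exact Complex.re_le_norm _

/-- The space `𝒯(H)` of trace-class operators: those with finite trace norm. -/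
def TraceClass (H : Type*) [NormedAddCommGroup H] [InnerProductSpace ℂ H] [CompleteSpace H] :
    Submodule ℂ (H →L[ℂ] H) where
  carrier := {A | traceNorm A < ∞}
  zero_mem' := traceNorm_lt_top_of_tsum (by simp)
  add_mem' {A B} hA hB := traceNorm_lt_top_of_tsum fun U => by
    have h := ENNReal.add_lt_top.2
      ⟨tsum_norm_inner_lt_top hA (onb H).orthonormal U (ContinuousLinearMap.id ℂ H),
        tsum_norm_inner_lt_top hB (onb H).orthonormal U (ContinuousLinearMap.id ℂ H)⟩
    rw [← ENNReal.tsum_add] at h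
    refine lt_of_le_of_lt (ENNReal.tsum_le_tsum fun i => ?_) h
    rw [← ENNReal.ofReal_add (norm_nonneg _) (norm_nonneg _)]
    refine ENNReal.ofReal_le_ofReal ?_
    simp only [add_apply, inner_add_right, ContinuousLinearMap.id_apply]
    exact norm_add_le _ _
  smul_mem' c A hA := traceNorm_lt_top_of_tsum fun U => by
    have := tsum_norm_inner_lt_top hA (onb H).orthonormal U (ContinuousLinearMap.id ℂ H)
    simp only [smul_apply, inner_smul_right, norm_mul,
      ENNReal.ofReal_mul (norm_nonneg c), ENNReal.tsum_mul_left]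
    exact ENNReal.mul_lt_top ENNReal.ofReal_lt_top this

/-- The map `A ↦ X A Y` from `𝒯(H)` to `𝒯(K)`. -/
def sandwich (X : H →L[ℂ] K) (Y : K →L[ℂ] H) : TraceClass H →ₗ[ℂ] TraceClass K where
  toFun A := ⟨X ∘L (A : H →L[ℂ] H) ∘L Y, traceNorm_lt_top_of_tsum fun U => by
    have := tsum_norm_inner_lt_top A.2 (onb K).orthonormal (ContinuousLinearMap.adjoint X ∘L U) Y
    simpa [ContinuousLinearMap.adjoint_inner_left] using this⟩
  map_add' A B := by ext; simp
  map_smul' c A := by ext; simp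

end TraceClass

section States

variable {H : Type*} [NormedAddCommGroup H] [InnerProductSpace ℂ H] [CompleteSpace H]

/-- Density operators: positive semi-definite trace-class operators of trace one. -/
def IsDensity (ρ : TraceClass H) : Prop :=
  (ρ : H →L[ℂ] H).IsPositive ∧ trace (ρ : H →L[ℂ] H) = 1

/-- Pure states `|ψ⟩⟨ψ|`, with `ψ` a unit vector. -/
def IsPure (ρ : TraceClass H) : Prop :=
  ∃ ψ : H, ‖ψ‖ = 1 ∧ (ρ : H →L[ℂ] H) = InnerProductSpace.rankOne ℂ ψ ψ

/-- The fidelity `F(ρ, σ) = ‖√ρ √σ‖₁²`. -/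
def fidelity (ρ σ : TraceClass H) : ℝ≥0∞ :=
  traceNorm (CFC.sqrt (ρ : H →L[ℂ] H) ∘L CFC.sqrt (σ : H →L[ℂ] H)) ^ 2

/-- A POVM with `M` outcomes. -/
def IsPOVM {M : ℕ} (Λ : Fin M → H →L[ℂ] H) : Prop :=
  (∀ m, (Λ m).IsPositive) ∧ ∑ m, Λ m = ContinuousLinearMap.id ℂ H

end States

section Tensor

/-- The Hilbert space tensor product: the completion of the algebraic tensor product. -/
abbrev HTensor (H K : Type*) [NormedAddCommGroup H] [InnerProductSpace ℂ H]
    [NormedAddCommGroup K] [InnerProductSpace ℂ K] : Type _ :=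
  UniformSpace.Completion (H ⊗[ℂ] K)

variable {H K : Type*}
  [NormedAddCommGroup H] [InnerProductSpace ℂ H] [CompleteSpace H]
  [NormedAddCommGroup K] [InnerProductSpace ℂ K] [CompleteSpace K]

/-- The operator `|h⟩ ⊗ I : K → H ⊗ K`, `k ↦ h ⊗ k`. Its adjoint is `⟨h| ⊗ I`. -/
def ketLeft (h : H) : K →L[ℂ] HTensor H K :=
  UniformSpace.Completion.toComplL ∘L TensorProduct.mkL ℂ H K h

/-- The operator `I ⊗ |k⟩ : H → H ⊗ K`, `h ↦ h ⊗ k`. Its adjoint is `I ⊗ ⟨k|`. -/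
def ketRight (k : K) : H →L[ℂ] HTensor H K :=
  UniformSpace.Completion.toComplL ∘L (TensorProduct.mkL ℂ H K).flip k

/-- The partial trace over the second factor, `∑ₗ (I ⊗ ⟨l|) X (I ⊗ |l⟩)`
(the series converges absolutely in operator norm whenever `X` is trace class). -/
def partialTraceRight (X : HTensor H K →L[ℂ] HTensor H K) : H →L[ℂ] H :=
  ∑' l, ContinuousLinearMap.adjoint (ketRight (onb K l)) ∘L X ∘L ketRight (onb K l)

/-- The partial trace over the first factor, `∑ₗ (⟨l| ⊗ I) X (|l⟩ ⊗ I)`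
(the series converges absolutely in operator norm whenever `X` is trace class). -/
def partialTraceLeft (X : HTensor H K →L[ℂ] HTensor H K) : K →L[ℂ] K :=
  ∑' l, ContinuousLinearMap.adjoint (ketLeft (onb H l)) ∘L X ∘L ketLeft (onb H l)

end Tensor

section TensorPower

/-- Finite formal linear combinations of `n`-tuples of vectors `x₁ ⊗ ⋯ ⊗ xₙ`. -/
def PreTPow (n : ℕ) (H : Type*) : Type _ := (Fin n → H) →₀ ℂ

/-- The formal generator `x₁ ⊗ ⋯ ⊗ xₙ`. -/
def PreTPow.of {n : ℕ} {H : Type*} (x : Fin n → H) : PreTPow n H := Finsupp.single x 1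

instance (n : ℕ) (H : Type*) : AddCommGroup (PreTPow n H) :=
  inferInstanceAs (AddCommGroup ((Fin n → H) →₀ ℂ))

instance (n : ℕ) (H : Type*) : Module ℂ (PreTPow n H) :=
  inferInstanceAs (Module ℂ ((Fin n → H) →₀ ℂ))

theorem PreTPow.span_range_of (n : ℕ) (H : Type*) :
    Submodule.span ℂ (Set.range (PreTPow.of : (Fin n → H) → PreTPow n H)) = ⊤ := by
  have key : ∀ f : (Fin n → H) →₀ ℂ, f ∈ Submodule.span ℂ
      (Set.range fun x : Fin n → H => (Finsupp.single x 1 : (Fin n → H) →₀ ℂ)) := by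
    intro f
    rw [← Finsupp.sum_single f]
    refine Submodule.sum_mem _ fun x _ => ?_
    have : Finsupp.single x (f x) = f x • (Finsupp.single x 1 : (Fin n → H) →₀ ℂ) := by simp
    rw [this]
    exact Submodule.smul_mem _ _ (Submodule.subset_span ⟨x, rfl⟩)
  exact eq_top_iff.2 fun f _ => key f

variable {n : ℕ} {H : Type*} [NormedAddCommGroup H] [InnerProductSpace ℂ H]

theorem posSemidef_inner {κ : Type*} (v : κ → H) :
    (Matrix.of fun x y : κ => ⟪v x, v y⟫_ℂ).PosSemidef := by
  refine ⟨?_, fun f => ?_⟩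
  · ext x y
    simp
  · have h : (f.sum fun i xi => f.sum fun j xj =>
        star xi * (Matrix.of fun x y : κ => ⟪v x, v y⟫_ℂ) i j * xj) =
        ⟪f.sum fun i xi => xi • v i, f.sum fun i xi => xi • v i⟫_ℂ := by
      simp only [Finsupp.sum, sum_inner, inner_smul_left, Matrix.of_apply]
      refine Finset.sum_congr rfl fun x _ => ?_
      rw [inner_sum, Finset.mul_sum]
      refine Finset.sum_congr rfl fun y _ => ?_
      rw [inner_smul_right, mul_assoc, mul_comm (f y)]
      rfl
    rw [h, inner_self_eq_norm_sq_to_K]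
    have : (0 : ℝ) ≤ ‖f.sum fun i xi => xi • v i‖ ^ 2 := by positivity
    refine (Complex.zero_le_real.2 this).trans_eq ?_
    push_cast
    rfl

theorem posSemidef_prod_inner (n : ℕ) (H : Type*) [NormedAddCommGroup H]
    [InnerProductSpace ℂ H] :
    (Matrix.of fun x y : Fin n → H => ∏ i, ⟪x i, y i⟫_ℂ).PosSemidef := by
  have key : ∀ s : Finset (Fin n),
      (Matrix.of fun x y : Fin n → H => ∏ i ∈ s, ⟪x i, y i⟫_ℂ).PosSemidef := by
    intro s
    induction s using Finset.induction_on with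
    | empty =>
      have h : (Matrix.of fun x y : Fin n → H => ∏ i ∈ (∅ : Finset (Fin n)), ⟪x i, y i⟫_ℂ) =
          Matrix.of fun _ _ : Fin n → H => ⟪(1 : ℂ), (1 : ℂ)⟫_ℂ := by
        ext x y
        simp
      rw [h]
      exact posSemidef_inner (fun _ : Fin n → H => (1 : ℂ))
    | insert i s hi ih =>
      have h : (Matrix.of fun x y : Fin n → H => ∏ j ∈ insert i s, ⟪x j, y j⟫_ℂ) =
          Matrix.hadamard (Matrix.of fun x y : Fin n → H => ⟪x i, y i⟫_ℂ)
            (Matrix.of fun x y : Fin n → H => ∏ j ∈ s, ⟪x j, y j⟫_ℂ) := by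
        ext x y
        simp [Finset.prod_insert hi]
      rw [h]
      exact (posSemidef_inner (fun x : Fin n → H => x i)).hadamard ih
  exact key Finset.univ

/-- The sesquilinear form determined by
`⟨x₁ ⊗ ⋯ ⊗ xₙ, y₁ ⊗ ⋯ ⊗ yₙ⟩ = ∏ᵢ ⟨xᵢ, yᵢ⟩`. -/
instance : PreInnerProductSpace.Core ℂ (PreTPow n H) where
  inner f g := Finsupp.sum f fun x a => Finsupp.sum g fun y b =>
    starRingEnd ℂ a * (∏ i, ⟪x i, y i⟫_ℂ) * b
  conj_inner_symm f g := by
    simp only [Finsupp.sum, map_sum, map_mul, map_prod, inner_conj_symm, Complex.conj_conj]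
    rw [Finset.sum_comm]
    refine Finset.sum_congr rfl fun x _ => Finset.sum_congr rfl fun y _ => by ring
  re_inner_nonneg f := by
    have := (posSemidef_prod_inner n H).2 f
    exact (Complex.nonneg_iff.1 this).1
  add_left f g h := by
    refine Finsupp.sum_add_index' (by simp [Finsupp.sum]) fun x a b => ?_
    simp only [Finsupp.sum, ← Finset.sum_add_distrib]
    refine Finset.sum_congr rfl fun y _ => by simp; ring
  smul_left f g r := by
    refine (Finsupp.sum_smul_index' (by simp [Finsupp.sum])).trans ?_
    simp only [Finsupp.sum, Finset.mul_sum]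
    refine Finset.sum_congr rfl fun x _ => Finset.sum_congr rfl fun y _ => by simp; ring

instance : SeminormedAddCommGroup (PreTPow n H) :=
  InnerProductSpace.Core.toSeminormedAddCommGroup (𝕜 := ℂ)

instance : InnerProductSpace ℂ (PreTPow n H) := InnerProductSpace.ofCore inferInstance

/-- The Hilbert space tensor power `H ⊗ ⋯ ⊗ H` (`n` factors): the Hilbert space generated by the
product vectors `x₁ ⊗ ⋯ ⊗ xₙ`, subject to
`⟨x₁ ⊗ ⋯ ⊗ xₙ, y₁ ⊗ ⋯ ⊗ yₙ⟩ = ∏ᵢ ⟨xᵢ, yᵢ⟩` (the completion divides out null vectors, and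
with them the multilinearity relations). -/
abbrev TPow (n : ℕ) (H : Type*) [NormedAddCommGroup H] [InnerProductSpace ℂ H] : Type _ :=
  UniformSpace.Completion (PreTPow n H)

/-- The product vector `x₁ ⊗ ⋯ ⊗ xₙ`. -/
def tprod (x : Fin n → H) : TPow n H :=
  (PreTPow.of x : PreTPow n H)

theorem inner_tprod (x y : Fin n → H) : ⟪tprod x, tprod y⟫_ℂ = ∏ i, ⟪x i, y i⟫_ℂ := by
  unfold tprod
  rw [UniformSpace.Completion.inner_coe]
  change (Finsupp.single x (1 : ℂ)).sum (fun x a => (Finsupp.single y (1 : ℂ)).sum fun y b =>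
    starRingEnd ℂ a * (∏ i, ⟪x i, y i⟫_ℂ) * b) = _
  rw [Finsupp.sum_single_index (by simp [Finsupp.sum]), Finsupp.sum_single_index (by simp)]
  simp

theorem norm_tprod (x : Fin n → H) : ‖tprod x‖ = ∏ i, ‖x i‖ := by
  have h := inner_tprod x x
  simp only [inner_self_eq_norm_sq_to_K, Finset.prod_pow] at h
  refine (pow_left_inj₀ (norm_nonneg _) (Finset.prod_nonneg fun _ _ => norm_nonneg _)
    two_ne_zero).1 ?_
  refine Complex.ofReal_injective ?_
  push_cast
  exact h

theorem eq_zero_of_inner_tprod {v : TPow n H} (h : ∀ x, ⟪tprod x, v⟫_ℂ = 0) : v = 0 := by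
  have h1 : ∀ w : TPow n H, ⟪w, v⟫_ℂ = 0 := by
    intro w
    induction w using UniformSpace.Completion.induction_on with
    | hp => exact isClosed_eq (by fun_prop) continuous_const
    | ih f =>
      have hf : f ∈ Submodule.span ℂ (Set.range (PreTPow.of : (Fin n → H) → PreTPow n H)) := by
        rw [PreTPow.span_range_of]
        trivial
      induction hf using Submodule.span_induction with
      | mem f hf =>
        obtain ⟨x, rfl⟩ := hf
        exact h x
      | zero => rw [UniformSpace.Completion.coe_zero, inner_zero_left]
      | add f g _ _ hf hg => rw [UniformSpace.Completion.coe_add, inner_add_left, hf, hg, add_zero]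
      | smul a f _ hf => rw [UniformSpace.Completion.coe_smul, inner_smul_left, hf, mul_zero]
  exact inner_self_eq_zero.1 (h1 v)

theorem ext_inner_tprod {v w : TPow n H} (h : ∀ x, ⟪tprod x, v⟫_ℂ = ⟪tprod x, w⟫_ℂ) : v = w :=
  sub_eq_zero.1 (eq_zero_of_inner_tprod fun x => by rw [inner_sub_right, h, sub_self])

/-- `h ↦ x₁ ⊗ ⋯ ⊗ h ⊗ ⋯ ⊗ xₙ`, with `h` in position `i`. -/
def tprodUpdate (x : Fin n → H) (i : Fin n) : H →L[ℂ] TPow n H :=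
  LinearMap.mkContinuous
    { toFun := fun h => tprod (Function.update x i h)
      map_add' := fun a b => ext_inner_tprod fun y => by
        simp only [inner_add_right, inner_tprod, ← Finset.mul_prod_erase _ _ (Finset.mem_univ i),
          Function.update_self, add_mul]
        congr 2 <;> refine Finset.prod_congr rfl fun j hj => ?_ <;>
          simp [Finset.ne_of_mem_erase hj]
      map_smul' := fun c a => ext_inner_tprod fun y => by
        simp only [inner_smul_right, inner_tprod, ← Finset.mul_prod_erase _ _ (Finset.mem_univ i),
          Function.update_self, mul_assoc, RingHom.id_apply]
        congr 2
        refine Finset.prod_congr rfl fun j hj => ?_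
        simp [Finset.ne_of_mem_erase hj] }
    (∏ j ∈ Finset.univ.erase i, ‖x j‖) fun h => by
      change ‖tprod (Function.update x i h)‖ ≤ _
      rw [norm_tprod, ← Finset.mul_prod_erase _ _ (Finset.mem_univ i), Function.update_self,
        mul_comm]
      refine le_of_eq (congrArg (· * ‖h‖) (Finset.prod_congr rfl fun j hj => ?_))
      simp [Finset.ne_of_mem_erase hj]

theorem orthonormal_tprod {ι : Type*} {b : ι → H} (hb : Orthonormal ℂ b) :
    Orthonormal ℂ fun J : Fin n → ι => tprod fun i => b (J i) := by
  classical
  rw [orthonormal_iff_ite] at hb ⊢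
  intro J J'
  simp only [inner_tprod, hb, Finset.prod_ite_zero, Finset.prod_const_one, Finset.mem_univ,
    true_imp_iff, funext_iff]

theorem eq_zero_of_inner_tprod_basis {ι : Type*} (b : HilbertBasis ι ℂ H) {v : TPow n H}
    (h : ∀ J : Fin n → ι, ⟪v, tprod fun i => b (J i)⟫_ℂ = 0) : v = 0 := by
  have key : ∀ s : Finset (Fin n), ∀ x : Fin n → H, (∀ i ∉ s, x i ∈ Set.range b) →
      ⟪v, tprod x⟫_ℂ = 0 := by
    intro s
    induction s using Finset.induction_on with
    | empty =>
      intro x hx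
      choose J hJ using fun i => hx i (by simp)
      rw [← h J]
      congr 2
      exact funext fun i => (hJ i).symm
    | insert i s hi ih =>
      intro x hx
      have h0 : innerSL ℂ v ∘L tprodUpdate x i = 0 := by
        refine ContinuousLinearMap.ext_on (s := Set.range b) ?_ ?_
        · exact Submodule.dense_iff_topologicalClosure_eq_top.2 b.dense_span
        · rintro _ ⟨j, rfl⟩
          change ⟪v, tprod (Function.update x i (b j))⟫_ℂ = 0
          refine ih _ fun k hk => ?_
          by_cases hki : k = i
          · subst hki
            simp
          · rw [Function.update_of_ne hki]
            exact hx k (by simp [hki, hk])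
      have h1 := congrArg (fun f : H →L[ℂ] ℂ => f (x i)) h0
      change ⟪v, tprod (Function.update x i (x i))⟫_ℂ = 0 at h1
      rwa [Function.update_eq_self] at h1
  refine eq_zero_of_inner_tprod fun x => ?_
  rw [← inner_conj_symm, key Finset.univ x (by simp), map_zero]

/-- The orthonormal basis of product vectors of `H ⊗ ⋯ ⊗ H`. -/
def tpowBasis {ι : Type*} (n : ℕ) (b : HilbertBasis ι ℂ H) :
    HilbertBasis (Fin n → ι) ℂ (TPow n H) :=
  HilbertBasis.mkOfOrthogonalEqBot (orthonormal_tprod b.orthonormal)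
    ((Submodule.eq_bot_iff _).2 fun v hv => eq_zero_of_inner_tprod_basis b fun J =>
      (Submodule.mem_orthogonal' _ v).1 hv _ (Submodule.subset_span ⟨J, rfl⟩))

end TensorPower

section Channels

variable {H K S S' : Type*}
  [NormedAddCommGroup H] [InnerProductSpace ℂ H] [CompleteSpace H]
  [NormedAddCommGroup K] [InnerProductSpace ℂ K] [CompleteSpace K]
  [NormedAddCommGroup S] [InnerProductSpace ℂ S] [CompleteSpace S]
  [NormedAddCommGroup S'] [InnerProductSpace ℂ S'] [CompleteSpace S']

/-- Complete positivity: for every `k`, the map `id ⊗ N` sends positive semi-definite `k × k`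
operator matrices (that is, operators on `ℂᵏ ⊗ H`) with entries in `𝒯(H)` to positive
semi-definite operator matrices. -/
def IsCompletelyPositive (N : TraceClass H →ₗ[ℂ] TraceClass K) : Prop :=
  ∀ (k : ℕ) (τ : Fin k → Fin k → TraceClass H),
    (∀ x : Fin k → H, 0 ≤ ∑ i, ∑ j, ⟪x i, (τ i j : H →L[ℂ] H) (x j)⟫_ℂ) →
    ∀ y : Fin k → K, 0 ≤ ∑ i, ∑ j, ⟪y i, (N (τ i j) : K →L[ℂ] K) (y j)⟫_ℂ

/-- Quantum channels: completely positive trace-preserving linear maps `𝒯(H) → 𝒯(K)`. -/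
structure IsChannel (N : TraceClass H →ₗ[ℂ] TraceClass K) : Prop where
  completelyPositive : IsCompletelyPositive N
  tracePreserving : ∀ τ, trace (N τ : K →L[ℂ] K) = trace (τ : H →L[ℂ] H)

/-- `N'` is complementary to `N`: there is an isometry `U : H → K ⊗ S` with
`N τ = Tr_S (U τ U†)` and `N' τ = Tr_K (U τ U†)`. -/
def IsComplementary (N : TraceClass H →ₗ[ℂ] TraceClass K) (N' : TraceClass H →ₗ[ℂ] TraceClass S) :
    Prop :=
  ∃ U : H →ₗᵢ[ℂ] HTensor K S, ∀ τ : TraceClass H,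
    (N τ : K →L[ℂ] K) = partialTraceRight (U.toContinuousLinearMap ∘L (τ : H →L[ℂ] H) ∘L
      ContinuousLinearMap.adjoint U.toContinuousLinearMap) ∧
    (N' τ : S →L[ℂ] S) = partialTraceLeft (U.toContinuousLinearMap ∘L (τ : H →L[ℂ] H) ∘L
      ContinuousLinearMap.adjoint U.toContinuousLinearMap)

/-- `T = T₁ ⊗ ⋯ ⊗ Tₙ` as operators on `H ⊗ ⋯ ⊗ H`. -/
def IsProductOp {n : ℕ} (T : Fin n → H →L[ℂ] H) (X : TPow n H →L[ℂ] TPow n H) : Prop :=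
  ∀ x : Fin n → H, X (tprod x) = tprod fun i => T i (x i)

/-- `Φ` is a channel with `Φ (τ₁ ⊗ ⋯ ⊗ τₙ) = N τ₁ ⊗ ⋯ ⊗ N τₙ` for all trace-class `τᵢ`. -/
structure IsTensorPower (n : ℕ) (N : TraceClass H →ₗ[ℂ] TraceClass K)
    (Φ : TraceClass (TPow n H) →ₗ[ℂ] TraceClass (TPow n K)) : Prop where
  isChannel : IsChannel Φ
  map_product : ∀ (τ : Fin n → TraceClass H) (ρ : TraceClass (TPow n H)),
    IsProductOp (fun i => (τ i : H →L[ℂ] H)) (ρ : TPow n H →L[ℂ] TPow n H) →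
    IsProductOp (fun i => (N (τ i) : K →L[ℂ] K)) (Φ ρ : TPow n K →L[ℂ] TPow n K)

open Classical in
/-- The tensor power `N ⊗ ⋯ ⊗ N` of a channel `N`: the unique channel that acts on products by
`τ₁ ⊗ ⋯ ⊗ τₙ ↦ N τ₁ ⊗ ⋯ ⊗ N τₙ`. (It exists for every channel `N`; the value `0` is a dummy for
linear maps that are not channels.) -/
def tensorPower (n : ℕ) (N : TraceClass H →ₗ[ℂ] TraceClass K) :
    TraceClass (TPow n H) →ₗ[ℂ] TraceClass (TPow n K) :=
  if h : ∃ Φ, IsTensorPower n N Φ then h.choose else 0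

/-- `id_R ⊗ C` with `R = ℂᴹ`, that is
`X ↦ ∑ᵢⱼ |i⟩⟨j| ⊗ C ((⟨i| ⊗ I) X (|j⟩ ⊗ I))`. -/
def idTensor (M : ℕ) (C : TraceClass S →ₗ[ℂ] TraceClass S') :
    TraceClass (HTensor (EuclideanSpace ℂ (Fin M)) S) →ₗ[ℂ]
      TraceClass (HTensor (EuclideanSpace ℂ (Fin M)) S') :=
  ∑ i : Fin M, ∑ j : Fin M,
    sandwich (ketLeft (EuclideanSpace.single i (1 : ℂ)))
        (ContinuousLinearMap.adjoint (ketLeft (EuclideanSpace.single j (1 : ℂ)))) ∘ₗ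
      C ∘ₗ
      sandwich (ContinuousLinearMap.adjoint (ketLeft (EuclideanSpace.single i (1 : ℂ))))
        (ketLeft (EuclideanSpace.single j (1 : ℂ)))

end Channels

section Energy

/-- An energy observable `G = ∑ⱼ gⱼ |eⱼ⟩⟨eⱼ|`: an orthonormal basis of eigenvectors `eⱼ` and
non-negative, possibly unbounded, eigenvalues `gⱼ`. -/
structure EnergyObservable (ι H : Type*) [NormedAddCommGroup H] [InnerProductSpace ℂ H] where
  basis : HilbertBasis ι ℂ H
  level : ι → ℝ
  level_nonneg : ∀ j, 0 ≤ level j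

variable {ι H : Type*} [NormedAddCommGroup H] [InnerProductSpace ℂ H]

/-- The energy `Tr {G ρ} = sup_k Tr {Π_k G Π_k ρ}` of a state `ρ`, where `Π_k` is the spectral
projection of `G` for `[0, k]`; the trace is evaluated in the eigenbasis of `G`. -/
def EnergyObservable.energy (G : EnergyObservable ι H) (ρ : H →L[ℂ] H) : ℝ≥0∞ :=
  ⨆ k : ℕ, ∑' j : ι, if G.level j ≤ k then
    ENNReal.ofReal (G.level j * (⟪G.basis j, ρ (G.basis j)⟫_ℂ).re) else 0

/-- The `n`th extension `(1/n) (G ⊗ I ⊗ ⋯ ⊗ I + ⋯ + I ⊗ ⋯ ⊗ I ⊗ G)`: its eigenvectors are the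
products `e_{j₁} ⊗ ⋯ ⊗ e_{jₙ}`, with eigenvalues `(g_{j₁} + ⋯ + g_{jₙ}) / n`. -/
def EnergyObservable.extension (G : EnergyObservable ι H) (n : ℕ) :
    EnergyObservable (Fin n → ι) (TPow n H) where
  basis := tpowBasis n G.basis
  level J := (∑ i, G.level (J i)) / n
  level_nonneg J := div_nonneg (Finset.sum_nonneg fun i _ => G.level_nonneg (J i)) n.cast_nonneg

end Energy

section Codes

variable {A B E ι : Type*}
  [NormedAddCommGroup A] [InnerProductSpace ℂ A] [CompleteSpace A]
  [NormedAddCommGroup B] [InnerProductSpace ℂ B] [CompleteSpace B]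
  [NormedAddCommGroup E] [InnerProductSpace ℂ E] [CompleteSpace E]

/-- An `(n, M, G, P, ε)` code for quantum communication over `N` with uniform energy constraint. -/
structure QuantumCode (N : TraceClass A →ₗ[ℂ] TraceClass B) (G : EnergyObservable ι A)
    (n M : ℕ) (P ε : ℝ) where
  enc : TraceClass (EuclideanSpace ℂ (Fin M)) →ₗ[ℂ] TraceClass (TPow n A)
  dec : TraceClass (TPow n B) →ₗ[ℂ] TraceClass (EuclideanSpace ℂ (Fin M))
  enc_isChannel : IsChannel enc
  dec_isChannel : IsChannel dec
  energy_le : ∀ ρ, IsDensity ρ →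
    (G.extension n).energy (enc ρ : TPow n A →L[ℂ] TPow n A) ≤ ENNReal.ofReal P
  fidelity_ge : ∀ φ : TraceClass (HTensor (EuclideanSpace ℂ (Fin M)) (EuclideanSpace ℂ (Fin M))),
    IsPure φ →
      ENNReal.ofReal (1 - ε) ≤ fidelity φ (idTensor M (dec ∘ₗ tensorPower n N ∘ₗ enc) φ)

/-- An `(n, M, G, P, ε)` code for private communication over `N`, with complementary channel `N'`,
with uniform energy constraint. -/
structure PrivateCode (N : TraceClass A →ₗ[ℂ] TraceClass B) (N' : TraceClass A →ₗ[ℂ] TraceClass E)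
    (G : EnergyObservable ι A) (n M : ℕ) (P ε : ℝ) where
  codeword : Fin M → TraceClass (TPow n A)
  povm : Fin M → TPow n B →L[ℂ] TPow n B
  envState : TraceClass (TPow n E)
  codeword_isDensity : ∀ m, IsDensity (codeword m)
  povm_isPOVM : IsPOVM povm
  envState_isDensity : IsDensity envState
  energy_le : ∀ m,
    (G.extension n).energy (codeword m : TPow n A →L[ℂ] TPow n A) ≤ ENNReal.ofReal P
  decoding : ∀ m, 1 - ε ≤
    (trace (povm m ∘L (tensorPower n N (codeword m) : TPow n B →L[ℂ] TPow n B))).re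
  security : ∀ m,
    2⁻¹ * traceNorm (tensorPower n N' (codeword m) - envState : TPow n E →L[ℂ] TPow n E) ≤
      ENNReal.ofReal ε

end Codes

end QInfo

end

open scoped ENNReal TensorProduct InnerProductSpace ComplexOrder

noncomputable section

namespace QInfo

set_option linter.unusedSectionVars false

/-! ### Trace-class operators as square-summable sums of dyads. -/

section Dyadic

open InnerProductSpace (rankOne)

variable {H K κ ι : Type*}
  [NormedAddCommGroup H] [InnerProductSpace ℂ H] [CompleteSpace H]
  [NormedAddCommGroup K] [InnerProductSpace ℂ K] [CompleteSpace K]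

/-! Encode the message `m` as the code state `C(|m⟩⟨m|)` of the quantum encoder and measure with the
Heisenberg images `Λₘ = D†(|m⟩⟨m|)` of the decoder. The energy bound is inherited, because the
quantum code satisfies it on every input state. Correct decoding is the fidelity criterion on the
product state `|m⟩|m⟩`. What needs proof is security.

Let `U` be the common dilation of the `n`-fold channels. Write `C(|i⟩⟨j|) = ∑ₖ |aₖᵢ⟩⟨aₖⱼ|` and
`⟨i|D(τ)|j⟩ = ∑ₗ ⟨gₗᵢ, τ gₗⱼ⟩`, and put `w(k,l),i,m = (⟨gₗᵢ| ⊗ I) U aₖₘ`, a vector of the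
environment. Since `∑ |gₗᵢ⟩⟨gₗᵢ| = I`, the environment state of message `m` is the sum of the dyads
of `w p i m` over `p = (k,l)` and `i` (`isDyadicSum_channelLeft`). On the other hand `∑ₚ ⟨w p j j, w
p i i⟩` is the matrix element `⟨i|DNC(|i⟩⟨j|)|j⟩` (`hasSum_inner_envVector`). The fidelity criterion
on the maximally entangled state therefore says that `F = M⁻² ∑ₚ ‖∑ᵢ w p i i‖²` is at least `1 - ε`.

So the families `p ↦ w p m m` have a long average. Let `v` be their normalized sum and `ω = ∑ₚ
|vₚ⟩⟨vₚ|`. The overlaps `cₘ` of the purification of the environment state with that of `ω` have mean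
`√F`, and by Markov's inequality at least `M / 2` messages satisfy `1 - cₘ ≤ 2(1 - √F)`. For them
the trace distance is at most `√(1 - cₘ²) ≤ 2√ε` (`exists_common_state`). The discarded outcomes are
merged into one that is kept.

The remaining work is infinite-dimensional. Channels are shown to be normal (`hasSum_functional`,
`IsChannel.exists_dual`), which legitimizes the series above and shows that a channel is determined
by its values on matrix units (`IsChannel.ext_basis`). This identifies the chosen `tensorPower` with
the map obtained from the tensor power of the dilation. -/

theorem summable_mul_of_sq {f g : κ → ℝ} (hf : Summable fun k => f k ^ 2)
    (hg : Summable fun k => g k ^ 2) : Summable fun k => f k * g k := by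
  refine Summable.of_norm_bounded (hf.add hg) fun k => ?_
  rw [Real.norm_eq_abs, abs_mul]
  nlinarith [sq_nonneg (|f k| - |g k|), sq_abs (f k), sq_abs (g k), sq_nonneg (|f k| + |g k|)]

theorem summable_mul_of_norm_sq {f g : κ → ℂ} (hf : Summable fun k => ‖f k‖ ^ 2)
    (hg : Summable fun k => ‖g k‖ ^ 2) : Summable fun k => f k * g k :=
  Summable.of_norm <| by simpa only [norm_mul] using summable_mul_of_sq hf hg

theorem summable_inner_of_norm_sq {f g : κ → H} (hf : Summable fun k => ‖f k‖ ^ 2)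
    (hg : Summable fun k => ‖g k‖ ^ 2) : Summable fun k => ⟪f k, g k⟫_ℂ :=
  Summable.of_norm_bounded (summable_mul_of_sq hf hg) fun _ => norm_inner_le_norm _ _

theorem hasSum_norm_sq_inner (e : HilbertBasis ι ℂ H) (x : H) :
    HasSum (fun i => ‖⟪e i, x⟫_ℂ‖ ^ 2) (‖x‖ ^ 2) := by
  have h := e.hasSum_inner_mul_inner x x
  have h2 : ∀ i, ⟪x, e i⟫_ℂ * ⟪e i, x⟫_ℂ = ((‖⟪e i, x⟫_ℂ‖ ^ 2 : ℝ) : ℂ) := by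
    intro i
    rw [← inner_conj_symm x (e i), ← Complex.normSq_eq_norm_sq, Complex.normSq_eq_conj_mul_self]
  have h3 : ⟪x, x⟫_ℂ = ((‖x‖ ^ 2 : ℝ) : ℂ) := by
    rw [inner_self_eq_norm_sq_to_K]; push_cast; rfl
  simp_rw [h2, h3] at h
  exact Complex.hasSum_ofReal.1 h

theorem summable_prod_norm_sq_inner (e : HilbertBasis ι ℂ H) {a : κ → H}
    (ha : Summable fun k => ‖a k‖ ^ 2) :
    Summable fun p : κ × ι => ‖⟪e p.2, a p.1⟫_ℂ‖ ^ 2 := by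
  refine (summable_prod_of_nonneg fun _ => by positivity).2
    ⟨fun k => (hasSum_norm_sq_inner e (a k)).summable, ?_⟩
  simpa only [(hasSum_norm_sq_inner e _).tsum_eq] using ha

theorem summable_norm_sq_apply {a : κ → H} (ha : Summable fun k => ‖a k‖ ^ 2) (Y : H →L[ℂ] K) :
    Summable fun k => ‖Y (a k)‖ ^ 2 := by
  refine Summable.of_nonneg_of_le (fun _ => by positivity) (fun k => ?_) (ha.mul_left (‖Y‖ ^ 2))
  rw [← mul_pow]
  exact pow_le_pow_left₀ (norm_nonneg _) (Y.le_opNorm _) 2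

/-- `X = ∑ₖ |aₖ⟩⟨bₖ|` with square-summable families `a` and `b`. -/
structure IsDyadicSum (X : H →L[ℂ] H) (a b : κ → H) : Prop where
  left : Summable fun k => ‖a k‖ ^ 2
  right : Summable fun k => ‖b k‖ ^ 2
  hasSum : ∀ y x, HasSum (fun k => ⟪y, a k⟫_ℂ * ⟪b k, x⟫_ℂ) ⟪y, X x⟫_ℂ

/-- The double family `⟨eᵢ, Y aₖ⟩⟨bₖ, eᵢ⟩` is a product of two square-summable families, so it may
be summed in either order; summing over `i` first is Parseval. The value does not involve `e`: this
is the basis independence of the trace. -/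
theorem IsDyadicSum.hasSum_inner_basis {X : H →L[ℂ] H} {a b : κ → H} (h : IsDyadicSum X a b)
    (e : HilbertBasis ι ℂ H) (Y : H →L[ℂ] H) :
    HasSum (fun i => ⟪e i, Y (X (e i))⟫_ℂ) (∑' k, ⟪b k, Y (a k)⟫_ℂ) := by
  have hs : Summable fun p : κ × ι => ⟪e p.2, Y (a p.1)⟫_ℂ * ⟪b p.1, e p.2⟫_ℂ := by
    have h1 := summable_prod_norm_sq_inner e (summable_norm_sq_apply h.left Y)
    have h2 : Summable fun p : κ × ι => ‖⟪b p.1, e p.2⟫_ℂ‖ ^ 2 :=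
      (summable_prod_norm_sq_inner e h.right).congr fun p => by rw [norm_inner_symm]
    exact summable_mul_of_norm_sq (f := fun p : κ × ι => ⟪e p.2, Y (a p.1)⟫_ℂ)
      (g := fun p : κ × ι => ⟪b p.1, e p.2⟫_ℂ) h1 h2
  have h1 : HasSum (fun p : κ × ι => ⟪e p.2, Y (a p.1)⟫_ℂ * ⟪b p.1, e p.2⟫_ℂ)
      (∑' k, ⟪b k, Y (a k)⟫_ℂ) := by
    have h2 := hs.hasSum.prod_fiberwise fun k => by
      have := e.hasSum_inner_mul_inner (b k) (Y (a k))
      simpa only [mul_comm] using this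
    rw [h2.tsum_eq]
    exact hs.hasSum
  have h3 := (Equiv.prodComm ι κ).hasSum_iff.2 h1
  refine h3.prod_fiberwise fun i => ?_
  have h4 := h.hasSum (ContinuousLinearMap.adjoint Y (e i)) (e i)
  simp only [ContinuousLinearMap.adjoint_inner_left] at h4
  exact h4

theorem IsDyadicSum.traceNorm_lt_top {X : H →L[ℂ] H} {a b : κ → H} (h : IsDyadicSum X a b) :
    traceNorm X < ∞ := by
  refine traceNorm_lt_top_of_tsum fun U => ?_
  have := (h.hasSum_inner_basis (onb H) (ContinuousLinearMap.adjoint U)).summable.norm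
  simp only [ContinuousLinearMap.adjoint_inner_right] at this
  exact this.tsum_ofReal_lt_top

theorem IsDyadicSum.trace_comp {X : H →L[ℂ] H} {a b : κ → H} (h : IsDyadicSum X a b)
    (Y : H →L[ℂ] H) : trace (Y ∘L X) = ∑' k, ⟪b k, Y (a k)⟫_ℂ :=
  (h.hasSum_inner_basis (onb H) Y).tsum_eq

theorem IsDyadicSum.hasSum_trace_comp {X : H →L[ℂ] H} {a b : κ → H} (h : IsDyadicSum X a b)
    (Y : H →L[ℂ] H) : HasSum (fun k => ⟪b k, Y (a k)⟫_ℂ) (trace (Y ∘L X)) := by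
  rw [h.trace_comp]
  exact (summable_inner_of_norm_sq h.right (summable_norm_sq_apply h.left Y)).hasSum

theorem IsDyadicSum.hasSum_trace {X : H →L[ℂ] H} {a b : κ → H} (h : IsDyadicSum X a b) :
    HasSum (fun k => ⟪b k, a k⟫_ℂ) (trace X) :=
  h.hasSum_trace_comp (ContinuousLinearMap.id ℂ H)

theorem tsum_ofReal_lt_top_iff {f : κ → ℝ} (hf : ∀ k, 0 ≤ f k) :
    ∑' k, ENNReal.ofReal (f k) < ∞ ↔ Summable f := by
  refine ⟨fun h => ?_, fun h => h.tsum_ofReal_lt_top⟩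
  have := ENNReal.summable_toReal h.ne
  simpa only [ENNReal.toReal_ofReal (hf _)] using this

theorem abs_of_isPositive {X : H →L[ℂ] H} (hX : X.IsPositive) : CFC.abs X = X :=
  CFC.abs_of_nonneg X ((ContinuousLinearMap.nonneg_iff_isPositive X).2 hX)

/-- The square root of a positive operator, as a self-adjoint operator. -/
theorem exists_sqrt {X : H →L[ℂ] H} (hX : X.IsPositive) :
    ∃ T : H →L[ℂ] H, ContinuousLinearMap.adjoint T = T ∧ ∀ x, T (T x) = X x := by
  have h0 := (ContinuousLinearMap.nonneg_iff_isPositive X).2 hX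
  exact ⟨CFC.sqrt X, (IsSelfAdjoint.of_nonneg (CFC.sqrt_nonneg X)).adjoint_eq, fun x =>
    congrArg (fun S : H →L[ℂ] H => S x) (CFC.sqrt_mul_sqrt_self X h0)⟩

theorem inner_eq_inner_sqrt {X T : H →L[ℂ] H} (hT : ContinuousLinearMap.adjoint T = T)
    (hTT : ∀ x, T (T x) = X x) (y x : H) : ⟪y, X x⟫_ℂ = ⟪T y, T x⟫_ℂ := by
  rw [← hTT, ← ContinuousLinearMap.adjoint_inner_left, hT]

/-- With `T = √X`, the vectors `T eᵢ` work: their squared norms add up to the trace of `X`, and the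
expansion is Parseval for `⟨T y, T x⟩`. -/
theorem exists_isDyadicSum_self {X : H →L[ℂ] H} (hX : X.IsPositive) (hX' : traceNorm X < ∞) :
    ∃ a : basisIndex H → H, IsDyadicSum X a a := by
  obtain ⟨T, hT, hTT⟩ := exists_sqrt hX
  have hs : Summable fun i => ‖T (onb H i)‖ ^ 2 := by
    rw [← tsum_ofReal_lt_top_iff fun _ => by positivity]
    refine lt_of_eq_of_lt (tsum_congr fun i => ?_) hX'
    rw [abs_of_isPositive hX, inner_eq_inner_sqrt hT hTT]
    congr 1
    exact (inner_self_eq_norm_sq (𝕜 := ℂ) _).symm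
  refine ⟨fun i => T (onb H i), hs, hs, fun y x => ?_⟩
  rw [inner_eq_inner_sqrt hT hTT]
  have h := (onb H).hasSum_inner_mul_inner (T y) (T x)
  have h1 : ∀ i, ⟪y, T (onb H i)⟫_ℂ = ⟪T y, onb H i⟫_ℂ := fun i => by
    rw [← ContinuousLinearMap.adjoint_inner_left, hT]
  have h2 : ∀ i, ⟪T (onb H i), x⟫_ℂ = ⟪onb H i, T x⟫_ℂ := fun i => by
    rw [← ContinuousLinearMap.adjoint_inner_right, hT]
  simpa only [h1, h2] using h

theorem IsDyadicSum.comp {X : H →L[ℂ] H} {a b : κ → H} (h : IsDyadicSum X a b)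
    (V W : H →L[ℂ] K) : IsDyadicSum (V ∘L X ∘L ContinuousLinearMap.adjoint W)
      (fun k => V (a k)) (fun k => W (b k)) := by
  refine ⟨summable_norm_sq_apply h.left V, summable_norm_sq_apply h.right W, fun y x => ?_⟩
  have := h.hasSum (ContinuousLinearMap.adjoint V y) (ContinuousLinearMap.adjoint W x)
  simp only [ContinuousLinearMap.adjoint_inner_left, ContinuousLinearMap.adjoint_inner_right]
    at this
  exact this

/-- Polar decomposition `X = W|X|` reduces this to the positive case, with `W` absorbed in the left
vectors. -/
theorem exists_isDyadicSum {X : H →L[ℂ] H} (hX : traceNorm X < ∞) :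
    ∃ a b : basisIndex H → H, IsDyadicSum X a b := by
  obtain ⟨W, hW, -⟩ := exists_polar X
  have hp : (CFC.abs X).IsPositive :=
    (ContinuousLinearMap.nonneg_iff_isPositive _).1 (CFC.abs_nonneg X)
  have ht : traceNorm (CFC.abs X) < ∞ := by
    unfold traceNorm
    rw [abs_of_isPositive hp]
    exact hX
  obtain ⟨a, ha⟩ := exists_isDyadicSum_self hp ht
  refine ⟨fun k => W (a k), a, ?_⟩
  have := ha.comp W (ContinuousLinearMap.id ℂ H)
  rw [ContinuousLinearMap.adjoint_id, ContinuousLinearMap.comp_id, hW] at this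
  exact this

theorem isDyadicSum_rankOne (a b : H) :
    IsDyadicSum (rankOne ℂ a b) (fun _ : Unit => a) (fun _ : Unit => b) := by
  refine ⟨(hasSum_fintype _).summable, (hasSum_fintype _).summable, fun y x => ?_⟩
  simp [mul_comm]

/-- The trace-class operator `|a⟩⟨b|`. -/
def dyad (a b : H) : TraceClass H := ⟨rankOne ℂ a b, (isDyadicSum_rankOne a b).traceNorm_lt_top⟩

@[simp] theorem coe_dyad (a b : H) : (dyad a b : H →L[ℂ] H) = rankOne ℂ a b := rfl

theorem trace_comp_dyad (Y : H →L[ℂ] H) (a b : H) :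
    trace (Y ∘L (dyad a b : H →L[ℂ] H)) = ⟪b, Y a⟫_ℂ := by
  have := ((isDyadicSum_rankOne a b).hasSum_trace_comp Y).unique (hasSum_fintype _)
  simpa using this

theorem trace_dyad (a b : H) : trace (dyad a b : H →L[ℂ] H) = ⟪b, a⟫_ℂ :=
  trace_comp_dyad (ContinuousLinearMap.id ℂ H) a b

/-- A square-summable dyadic sum converges in operator norm. -/
theorem summable_rankOne {a b : κ → H} (ha : Summable fun k => ‖a k‖ ^ 2)
    (hb : Summable fun k => ‖b k‖ ^ 2) : Summable fun k => rankOne ℂ (a k) (b k) :=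
  Summable.of_norm_bounded (summable_mul_of_sq ha hb) fun k => by
    rw [InnerProductSpace.norm_rankOne]

theorem hasSum_inner_apply {F : κ → H →L[ℂ] K} {X : H →L[ℂ] K} (h : HasSum F X) (y : K) (x : H) :
    HasSum (fun k => ⟪y, F k x⟫_ℂ) ⟪y, X x⟫_ℂ := by
  have h1 := h.mapL (innerSL ℂ y ∘L ContinuousLinearMap.apply ℂ K x)
  simpa using h1

theorem isDyadicSum_tsum {a b : κ → H} (ha : Summable fun k => ‖a k‖ ^ 2)
    (hb : Summable fun k => ‖b k‖ ^ 2) : IsDyadicSum (∑' k, rankOne ℂ (a k) (b k)) a b := by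
  refine ⟨ha, hb, fun y x => ?_⟩
  have := hasSum_inner_apply (summable_rankOne ha hb).hasSum y x
  simpa [inner_smul_right, mul_comm] using this

theorem IsDyadicSum.eq {X Y : H →L[ℂ] H} {a b : κ → H} (hX : IsDyadicSum X a b)
    (hY : IsDyadicSum Y a b) : X = Y :=
  ContinuousLinearMap.ext fun x => ext_inner_left ℂ fun y =>
    (hX.hasSum y x).unique (hY.hasSum y x)

theorem trace_comp_add (Y : H →L[ℂ] H) (σ τ : TraceClass H) :
    trace (Y ∘L ((σ + τ : TraceClass H) : H →L[ℂ] H)) =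
      trace (Y ∘L (σ : H →L[ℂ] H)) + trace (Y ∘L (τ : H →L[ℂ] H)) := by
  obtain ⟨a, b, h⟩ := exists_isDyadicSum σ.2
  obtain ⟨a', b', h'⟩ := exists_isDyadicSum τ.2
  have := (h.hasSum_inner_basis (onb H) Y).summable.tsum_add
    (h'.hasSum_inner_basis (onb H) Y).summable
  simpa [trace, inner_add_right] using this

theorem trace_comp_smul (Y : H →L[ℂ] H) (c : ℂ) (τ : TraceClass H) :
    trace (Y ∘L ((c • τ : TraceClass H) : H →L[ℂ] H)) = c * trace (Y ∘L (τ : H →L[ℂ] H)) := by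
  simp [trace, tsum_mul_left]

/-- The linear functional `τ ↦ Tr (Y τ)`. -/
def traceComp (Y : H →L[ℂ] H) : TraceClass H →ₗ[ℂ] ℂ where
  toFun τ := trace (Y ∘L (τ : H →L[ℂ] H))
  map_add' := trace_comp_add Y
  map_smul' := trace_comp_smul Y

theorem hasSum_trace_basis (e : HilbertBasis ι ℂ H) (τ : TraceClass H) :
    HasSum (fun i => ⟪e i, (τ : H →L[ℂ] H) (e i)⟫_ℂ) (trace (τ : H →L[ℂ] H)) := by
  obtain ⟨a, b, h⟩ := exists_isDyadicSum τ.2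
  have := h.hasSum_inner_basis e (ContinuousLinearMap.id ℂ H)
  rw [← h.trace_comp] at this
  exact this

/-- Polar decomposition with a contraction: `|A| = W A`. -/
theorem exists_contraction_comp_eq_abs (A : H →L[ℂ] H) :
    ∃ W : H →L[ℂ] H, ‖W‖ ≤ 1 ∧ W ∘L A = CFC.abs A := by
  let S : Submodule ℂ H := A.range.topologicalClosure
  have : CompleteSpace S := Submodule.isClosed_topologicalClosure _ |>.completeSpace_coe
  have hmem : ∀ x, A x ∈ S := fun x => Submodule.le_topologicalClosure _ ⟨x, rfl⟩
  let e : H →ₗ[ℂ] S := (A : H →ₗ[ℂ] H).codRestrict S hmem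
  have hd : DenseRange e := by
    intro y
    rw [Metric.mem_closure_range_iff]
    intro ε hε
    have hy : (y : H) ∈ closure (Set.range A) := y.2
    obtain ⟨x, hx⟩ := Metric.mem_closure_range_iff.1 hy ε hε
    exact ⟨x, hx⟩
  have hn : ∀ x, ‖((CFC.abs A : H →L[ℂ] H) : H →ₗ[ℂ] H) x‖ ≤ 1 * ‖e x‖ := fun x => by
    rw [one_mul]; exact (norm_abs_apply A x).le
  let W₀ : S →L[ℂ] H := ((CFC.abs A : H →L[ℂ] H) : H →ₗ[ℂ] H).extendOfNorm e
  refine ⟨W₀ ∘L S.orthogonalProjectionOnto, ?_, ?_⟩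
  · refine ContinuousLinearMap.opNorm_le_bound _ zero_le_one fun z => ?_
    refine (LinearMap.norm_extendOfNorm_apply_le hd 1 hn _).trans ?_
    gcongr
    exact Submodule.norm_orthogonalProjectionOnto_apply_le S z
  · ext x
    have : S.orthogonalProjectionOnto (A x) = e x :=
      Submodule.orthogonalProjectionOnto_mem_subspace_eq_self (K := S) (e x)
    change W₀ (S.orthogonalProjectionOnto (A x)) = CFC.abs A x
    rw [this]
    exact LinearMap.extendOfNorm_eq hd ⟨1, hn⟩ x

/-- The attained half of the duality between trace norm and operator norm. Every later upper bound
on a trace norm estimates `Tr(Wτ)` for this one contraction. -/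
theorem exists_traceNorm_eq (τ : TraceClass H) : ∃ W : H →L[ℂ] H, ‖W‖ ≤ 1 ∧
    traceNorm (τ : H →L[ℂ] H) = ENNReal.ofReal (trace (W ∘L (τ : H →L[ℂ] H))).re := by
  obtain ⟨W, hW, hWA⟩ := exists_contraction_comp_eq_abs (τ : H →L[ℂ] H)
  refine ⟨W, hW, ?_⟩
  obtain ⟨a, b, h⟩ := exists_isDyadicSum τ.2
  have hs := h.hasSum_inner_basis (onb H) W
  rw [← h.trace_comp] at hs
  have hW' : ∀ x, W ((τ : H →L[ℂ] H) x) = CFC.abs (τ : H →L[ℂ] H) x := fun x =>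
    congrArg (fun S : H →L[ℂ] H => S x) hWA
  simp only [hW'] at hs
  have hre := Complex.hasSum_re hs
  have hp : (CFC.abs (τ : H →L[ℂ] H)).IsPositive :=
    (ContinuousLinearMap.nonneg_iff_isPositive _).1 (CFC.abs_nonneg _)
  rw [← hre.tsum_eq, ENNReal.ofReal_tsum_of_nonneg (f := fun i =>
    (⟪onb H i, CFC.abs (τ : H →L[ℂ] H) (onb H i)⟫_ℂ).re) (fun i => hp.re_inner_nonneg_right _)
    hre.summable]
  rfl

theorem inner_le_trace {τ : TraceClass H} (hτ : (τ : H →L[ℂ] H).IsPositive) (x : H) :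
    ⟪x, (τ : H →L[ℂ] H) x⟫_ℂ ≤ (‖x‖ ^ 2 : ℝ) * trace (τ : H →L[ℂ] H) := by
  obtain ⟨a, ha⟩ := exists_isDyadicSum_self hτ τ.2
  refine hasSum_le (fun k => ?_) (ha.hasSum x x) (ha.hasSum_trace.mul_left _)
  have h1 : ⟪x, a k⟫_ℂ * ⟪a k, x⟫_ℂ = ((‖⟪x, a k⟫_ℂ‖ ^ 2 : ℝ) : ℂ) := by
    rw [← inner_conj_symm (a k) x, Complex.mul_conj, Complex.normSq_eq_norm_sq]
  have h2 : ⟪a k, a k⟫_ℂ = ((‖a k‖ ^ 2 : ℝ) : ℂ) := by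
    rw [inner_self_eq_norm_sq_to_K]; push_cast; rfl
  rw [h1, h2, ← Complex.ofReal_mul, Complex.real_le_real, ← mul_pow]
  exact pow_le_pow_left₀ (norm_nonneg _) (norm_inner_le_norm _ _) 2

end Dyadic

/-! ### Normality of channels and the Heisenberg picture. -/

section Duality

open InnerProductSpace (rankOne)

variable {H K κ ι : Type*}
  [NormedAddCommGroup H] [InnerProductSpace ℂ H] [CompleteSpace H]
  [NormedAddCommGroup K] [InnerProductSpace ℂ K] [CompleteSpace K]

theorem isPositive_of_inner_nonneg {T : H →L[ℂ] H} (h : ∀ x, 0 ≤ ⟪x, T x⟫_ℂ) : T.IsPositive := by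
  rw [ContinuousLinearMap.isPositive_iff_complex]
  intro x
  have hx := Complex.nonneg_iff.1 (h x)
  have hc := inner_conj_symm (𝕜 := ℂ) (T x) x
  have h1 : ⟪T x, x⟫_ℂ = ((⟪x, T x⟫_ℂ).re : ℂ) := by
    have h2 := Complex.conj_eq_iff_im.2 hx.2.symm
    rw [← hc, h2]
    exact (Complex.conj_eq_iff_re.1 h2).symm
  rw [h1]
  simpa using hx.1

theorem dyad_add_left (a a' b : H) : dyad (a + a') b = dyad a b + dyad a' b :=
  Subtype.ext (by simp)

theorem dyad_add_right (a b b' : H) : dyad a (b + b') = dyad a b + dyad a b' :=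
  Subtype.ext (by simp)

theorem dyad_smul_left (c : ℂ) (a b : H) : dyad (c • a) b = c • dyad a b :=
  Subtype.ext (by simp)

theorem dyad_smul_right (c : ℂ) (a b : H) : dyad a (c • b) = starRingEnd ℂ c • dyad a b :=
  Subtype.ext (by simp)

theorem isPositive_dyad_self (a : H) : (dyad a a : H →L[ℂ] H).IsPositive := by
  simp

theorem dyad_polarization (a b : H) : (4 : ℂ) • dyad a b =
    dyad (a + b) (a + b) - dyad (a + (-1 : ℂ) • b) (a + (-1 : ℂ) • b) +
    Complex.I • dyad (a + Complex.I • b) (a + Complex.I • b) -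
    Complex.I • dyad (a + (-Complex.I) • b) (a + (-Complex.I) • b) := by
  simp only [dyad_add_left, dyad_add_right, dyad_smul_left, dyad_smul_right, smul_add, smul_smul,
    map_neg, Complex.conj_I, map_one]
  have hI : Complex.I * Complex.I = -1 := Complex.I_mul_I
  simp only [mul_neg, neg_mul, hI, mul_one, neg_neg, one_smul, neg_smul]
  module

theorem IsDyadicSum.isPositive {X : H →L[ℂ] H} {a : κ → H} (h : IsDyadicSum X a a) :
    X.IsPositive := isPositive_of_inner_nonneg fun x => by
  refine (h.hasSum x x).nonneg fun k => ?_
  rw [← inner_conj_symm (a k) x, Complex.mul_conj]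
  exact Complex.zero_le_real.2 (Complex.normSq_nonneg _)

/-- The quadratic form of the remainder is a tail of a series with nonnegative terms. -/
theorem IsDyadicSum.isPositive_sub_sum {τ : TraceClass H} {a : κ → H}
    (h : IsDyadicSum (τ : H →L[ℂ] H) a a) (s : Finset κ) :
    ((τ - ∑ k ∈ s, dyad (a k) (a k) : TraceClass H) : H →L[ℂ] H).IsPositive :=
  isPositive_of_inner_nonneg fun x => by
    have h1 := sum_le_hasSum s (fun k _ => ?_) (h.hasSum x x)
    · simpa [inner_sub_right, inner_sum, inner_smul_right, mul_comm] using h1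
    · rw [← inner_conj_symm (a k) x, Complex.mul_conj]
      exact Complex.zero_le_real.2 (Complex.normSq_nonneg _)

theorem norm_le_of_nonneg_of_le {z w : ℂ} (hz : 0 ≤ z) (hzw : z ≤ w) : ‖z‖ ≤ ‖w‖ := by
  have h1 := Complex.norm_of_nonneg' hz
  have h2 := Complex.norm_of_nonneg' (hz.trans hzw)
  rw [← h1, ← h2] at hzw
  exact Complex.real_le_real.1 hzw

/-- A positive functional dominated by the trace is normal on positive operators. -/
theorem hasSum_functional_self {f : TraceClass H →ₗ[ℂ] ℂ} {C : ℝ}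
    (hf : ∀ τ : TraceClass H, (τ : H →L[ℂ] H).IsPositive →
      0 ≤ f τ ∧ f τ ≤ C * trace (τ : H →L[ℂ] H))
    {τ : TraceClass H} {a : κ → H} (h : IsDyadicSum (τ : H →L[ℂ] H) a a) :
    HasSum (fun k => f (dyad (a k) (a k))) (f τ) := by
  have htr : ∀ s : Finset κ, trace ((τ - ∑ k ∈ s, dyad (a k) (a k) : TraceClass H) : H →L[ℂ] H) =
      trace (τ : H →L[ℂ] H) - ∑ k ∈ s, ⟪a k, a k⟫_ℂ := fun s => by
    have := map_sub (traceComp (ContinuousLinearMap.id ℂ H)) τ (∑ k ∈ s, dyad (a k) (a k))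
    rw [map_sum] at this
    refine this.trans (congrArg _ (Finset.sum_congr rfl fun k _ => trace_dyad _ _))
  have hlim : Filter.Tendsto (fun s : Finset κ =>
      ‖(C : ℂ) * (trace (τ : H →L[ℂ] H) - ∑ k ∈ s, ⟪a k, a k⟫_ℂ)‖) Filter.atTop (nhds 0) := by
    have h1 := (tendsto_const_nhds (x := trace (τ : H →L[ℂ] H))).sub h.hasSum_trace
    have h2 := (h1.const_mul (C : ℂ)).norm
    simpa using h2
  have h0 : Filter.Tendsto (fun s : Finset κ => f τ - ∑ k ∈ s, f (dyad (a k) (a k)))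
      Filter.atTop (nhds 0) := by
    -- The remainder is positive, so `f` of it is at most `C` times its trace, and that trace tends
    -- to zero.
    refine squeeze_zero_norm (fun s => ?_) hlim
    rw [← map_sum, ← map_sub, ← htr]
    exact norm_le_of_nonneg_of_le (hf _ (h.isPositive_sub_sum s)).1
      (hf _ (h.isPositive_sub_sum s)).2
  have h1 := (tendsto_const_nhds (x := f τ)).sub h0
  simpa [HasSum] using h1

theorem summable_norm_sq_add {a b : κ → H} (ha : Summable fun k => ‖a k‖ ^ 2)
    (hb : Summable fun k => ‖b k‖ ^ 2) : Summable fun k => ‖a k + b k‖ ^ 2 := by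
  refine Summable.of_nonneg_of_le (fun _ => by positivity) (fun k => ?_)
    ((ha.add hb).mul_left 2)
  have := norm_add_le (a k) (b k)
  nlinarith [sq_nonneg (‖a k‖ - ‖b k‖), norm_nonneg (a k + b k), norm_nonneg (a k),
    norm_nonneg (b k)]

theorem summable_norm_sq_smul {b : κ → H} (c : ℂ) (hb : Summable fun k => ‖b k‖ ^ 2) :
    Summable fun k => ‖c • b k‖ ^ 2 := by
  simpa only [norm_smul, mul_pow] using hb.mul_left (‖c‖ ^ 2)

/-- The trace-class operator `∑ₖ |aₖ⟩⟨bₖ|`. -/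
def dyadSum (a b : κ → H) (ha : Summable fun k => ‖a k‖ ^ 2) (hb : Summable fun k => ‖b k‖ ^ 2) :
    TraceClass H :=
  ⟨∑' k, rankOne ℂ (a k) (b k), (isDyadicSum_tsum ha hb).traceNorm_lt_top⟩

theorem isDyadicSum_dyadSum {a b : κ → H} (ha : Summable fun k => ‖a k‖ ^ 2)
    (hb : Summable fun k => ‖b k‖ ^ 2) : IsDyadicSum (dyadSum a b ha hb : H →L[ℂ] H) a b :=
  isDyadicSum_tsum ha hb

/-- Applies `dyad_polarization` to each term, writing any trace-class operator through four positive
dyadic sums. It carries normality over from positive operators. -/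
theorem IsDyadicSum.polarization {τ : TraceClass H} {a b : κ → H}
    (h : IsDyadicSum (τ : H →L[ℂ] H) a b)
    (hc : ∀ c : ℂ, Summable fun k => ‖a k + c • b k‖ ^ 2) : (4 : ℂ) • τ =
    dyadSum _ _ (hc 1) (hc 1) - dyadSum _ _ (hc (-1)) (hc (-1)) +
    Complex.I • dyadSum _ _ (hc Complex.I) (hc Complex.I) -
    Complex.I • dyadSum _ _ (hc (-Complex.I)) (hc (-Complex.I)) := by
  refine Subtype.ext (ContinuousLinearMap.ext fun x => ext_inner_left ℂ fun y => ?_)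
  have hs : ∀ c, HasSum _ _ := fun c => (isDyadicSum_dyadSum (hc c) (hc c)).hasSum y x
  have h1 := (((hs 1).sub (hs (-1))).add ((hs Complex.I).mul_left Complex.I)).sub
    ((hs (-Complex.I)).mul_left Complex.I)
  have h2 := (h.hasSum y x).mul_left 4
  have h3 := h2.unique (h1.congr_fun ?_)
  · simpa [inner_add_right, inner_sub_right, inner_smul_right] using h3
  · intro k
    have := congrArg (fun T : TraceClass H => ⟪y, (T : H →L[ℂ] H) x⟫_ℂ)
      (dyad_polarization (a k) (b k))
    simp at this ⊢
    linear_combination this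

theorem hasSum_functional {f : TraceClass H →ₗ[ℂ] ℂ} {C : ℝ}
    (hf : ∀ τ : TraceClass H, (τ : H →L[ℂ] H).IsPositive →
      0 ≤ f τ ∧ f τ ≤ C * trace (τ : H →L[ℂ] H))
    {τ : TraceClass H} {a b : κ → H} (h : IsDyadicSum (τ : H →L[ℂ] H) a b) :
    HasSum (fun k => f (dyad (a k) (b k))) (f τ) := by
  have hc : ∀ c : ℂ, Summable fun k => ‖a k + c • b k‖ ^ 2 := fun c =>
    summable_norm_sq_add h.left (summable_norm_sq_smul c h.right)
  have hs : ∀ c : ℂ, HasSum (fun k => f (dyad (a k + c • b k) (a k + c • b k)))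
      (f (dyadSum _ _ (hc c) (hc c))) := fun c =>
    hasSum_functional_self hf (isDyadicSum_dyadSum (hc c) (hc c))
  have h1 := ((((hs 1).sub (hs (-1))).add ((hs Complex.I).mul_left Complex.I)).sub
    ((hs (-Complex.I)).mul_left Complex.I)).mul_left (4⁻¹ : ℂ)
  have h2 := congrArg f (h.polarization hc)
  simp only [map_sub, map_add, map_smul, smul_eq_mul] at h2
  rw [← h2, inv_mul_cancel_left₀ (by norm_num)] at h1
  refine h1.congr_fun fun k => ?_
  have h3 := congrArg f (dyad_polarization (a k) (b k))
  simp only [map_sub, map_add, map_smul, smul_eq_mul] at h3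
  rw [one_smul, ← h3, inv_mul_cancel_left₀ (by norm_num)]

theorem norm_functional_dyad_le {f : TraceClass H →ₗ[ℂ] ℂ} {C : ℝ} (hC : 0 ≤ C)
    (hf : ∀ τ : TraceClass H, (τ : H →L[ℂ] H).IsPositive →
      0 ≤ f τ ∧ f τ ≤ C * trace (τ : H →L[ℂ] H)) (b a : H) :
    ‖f (dyad a b)‖ ≤ 4 * C * ‖b‖ * ‖a‖ := by
  have h1 : ∀ c : H, ‖f (dyad c c)‖ ≤ C * ‖c‖ ^ 2 := fun c => by
    have := hf _ (isPositive_dyad_self c)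
    refine (norm_le_of_nonneg_of_le this.1 this.2).trans_eq ?_
    rw [trace_dyad, norm_mul, inner_self_eq_norm_sq_to_K]
    simp [abs_of_nonneg hC]
  have h2 : ∀ a b : H, ‖a‖ = 1 → ‖b‖ = 1 → ‖f (dyad a b)‖ ≤ 4 * C := by
    intro a b ha hb
    have h3 := congrArg f (dyad_polarization a b)
    simp only [map_sub, map_add, map_smul, smul_eq_mul] at h3
    -- For unit vectors each of the four polarization terms is at most `C · 2²`; their sum `16C` is
    -- divided by the factor `4` of the polarization identity.
    have h4 : ∀ c : ℂ, ‖c‖ = 1 → ‖f (dyad (a + c • b) (a + c • b))‖ ≤ 4 * C := fun c hc => by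
      refine (h1 _).trans ?_
      have : ‖a + c • b‖ ≤ 2 := (norm_add_le _ _).trans_eq (by rw [norm_smul, ha, hb, hc]; norm_num)
      nlinarith [norm_nonneg (a + c • b), mul_le_mul_of_nonneg_left
        (pow_le_pow_left₀ (norm_nonneg (a + c • b)) this 2) hC]
    have h5 := h4 1 (by simp)
    rw [one_smul] at h5
    have h6 := congrArg norm h3
    rw [norm_mul] at h6
    have h7 : ‖(4 : ℂ)‖ = 4 := by norm_num
    rw [h7] at h6
    have h8 := (norm_sub_le _ _).trans (add_le_add_left ((norm_add_le _ _).trans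
      (add_le_add_left (norm_sub_le _ _) _)) _) |>.trans' h6.le
    simp only [norm_mul, Complex.norm_I, one_mul] at h8
    linarith [h4 (-1) (by simp), h4 Complex.I (by simp), h4 (-Complex.I) (by simp)]
  rcases eq_or_ne a 0 with rfl | ha
  · have : dyad (0 : H) b = 0 := Subtype.ext (by simp)
    simp [this]
  rcases eq_or_ne b 0 with rfl | hb
  · have : dyad a (0 : H) = 0 := Subtype.ext (by simp)
    simp [this]
  have ha' := norm_pos_iff.2 ha
  have hb' := norm_pos_iff.2 hb
  have h9 := h2 ((‖a‖⁻¹ : ℂ) • a) ((‖b‖⁻¹ : ℂ) • b) (by simp [norm_smul, ha'.ne'])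
    (by simp [norm_smul, hb'.ne'])
  rw [dyad_smul_left, dyad_smul_right, map_smul, map_smul, norm_smul, norm_smul] at h9
  simp only [norm_inv, Complex.norm_real, norm_norm, RCLike.norm_conj] at h9
  rw [← mul_assoc, ← mul_inv, inv_mul_le_iff₀ (by positivity)] at h9
  linarith

/-- A positive functional on `𝒯(H)` dominated by the trace is `τ ↦ Tr (Λ τ)`. -/
theorem exists_functional_eq_trace {f : TraceClass H →ₗ[ℂ] ℂ} {C : ℝ} (hC : 0 ≤ C)
    (hf : ∀ τ : TraceClass H, (τ : H →L[ℂ] H).IsPositive →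
      0 ≤ f τ ∧ f τ ≤ C * trace (τ : H →L[ℂ] H)) :
    ∃ Λ : H →L[ℂ] H, ∀ τ : TraceClass H, f τ = trace (Λ ∘L (τ : H →L[ℂ] H)) := by
  let B₀ : H →ₗ⋆[ℂ] H →ₗ[ℂ] ℂ := LinearMap.mk₂'ₛₗ (starRingEnd ℂ) (RingHom.id ℂ)
    (fun b a => f (dyad a b))
    (fun b b' a => by rw [dyad_add_right, map_add])
    (fun c b a => by rw [dyad_smul_right, map_smul])
    (fun b a a' => by rw [dyad_add_left, map_add])
    (fun c b a => by rw [dyad_smul_left, map_smul]; rfl)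
  let B : H →L⋆[ℂ] H →L[ℂ] ℂ := B₀.mkContinuous₂ (4 * C) (norm_functional_dyad_le hC hf)
  -- The Riesz representation puts the operator in the first slot of the inner product; the adjoint
  -- moves it to the second, so that `⟨b, Λ a⟩ = f(|a⟩⟨b|)`.
  let Λ := ContinuousLinearMap.adjoint (InnerProductSpace.continuousLinearMapOfBilin B)
  have hΛ : ∀ a b, ⟪b, Λ a⟫_ℂ = f (dyad a b) := fun a b => by
    rw [ContinuousLinearMap.adjoint_inner_right,
      InnerProductSpace.continuousLinearMapOfBilin_apply]
    rfl
  refine ⟨Λ, fun τ => ?_⟩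
  obtain ⟨a, b, h⟩ := exists_isDyadicSum τ.2
  have h1 := h.hasSum_trace_comp Λ
  simp only [hΛ] at h1
  exact (hasSum_functional hf h).unique h1

/-- The functional `τ ↦ ⟨x, Φ(τ) y⟩`. -/
def matrixElement (Φ : TraceClass H →ₗ[ℂ] TraceClass K) (x y : K) : TraceClass H →ₗ[ℂ] ℂ where
  toFun τ := ⟪x, (Φ τ : K →L[ℂ] K) y⟫_ℂ
  map_add' σ τ := by simp
  map_smul' c τ := by simp

theorem IsCompletelyPositive.isPositive {Φ : TraceClass H →ₗ[ℂ] TraceClass K}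
    (hΦ : IsCompletelyPositive Φ) {τ : TraceClass H} (hτ : (τ : H →L[ℂ] H).IsPositive) :
    (Φ τ : K →L[ℂ] K).IsPositive := by
  refine isPositive_of_inner_nonneg fun x => ?_
  have := hΦ 1 (fun _ _ => τ) (fun x => by simpa using hτ.inner_nonneg_right (x 0)) fun _ => x
  simpa using this

theorem IsChannel.functional_bound {Φ : TraceClass H →ₗ[ℂ] TraceClass K} (hΦ : IsChannel Φ)
    (x : K) (τ : TraceClass H) (hτ : (τ : H →L[ℂ] H).IsPositive) :
    0 ≤ matrixElement Φ x x τ ∧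
      matrixElement Φ x x τ ≤ ((‖x‖ ^ 2 : ℝ) : ℂ) * trace (τ : H →L[ℂ] H) := by
  have h := hΦ.completelyPositive.isPositive hτ
  refine ⟨h.inner_nonneg_right x, ?_⟩
  rw [← hΦ.tracePreserving]
  exact inner_le_trace h x

/-- Matrix elements of the output of a channel are given by bounded operators on the input. -/
theorem IsChannel.exists_dual {Φ : TraceClass H →ₗ[ℂ] TraceClass K} (hΦ : IsChannel Φ) (x y : K) :
    ∃ Λ : H →L[ℂ] H, ∀ τ : TraceClass H,
      ⟪x, (Φ τ : K →L[ℂ] K) y⟫_ℂ = trace (Λ ∘L (τ : H →L[ℂ] H)) := by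
  have h : ∀ z : K, ∃ Λ : H →L[ℂ] H, ∀ τ : TraceClass H,
      ⟪z, (Φ τ : K →L[ℂ] K) z⟫_ℂ = trace (Λ ∘L (τ : H →L[ℂ] H)) := fun z =>
    exists_functional_eq_trace (sq_nonneg ‖z‖) (hΦ.functional_bound z)
  choose Λ hΛ using h
  -- Only diagonal matrix elements are positive functionals; the others are recovered by
  -- polarization in the output vectors.
  refine ⟨(4⁻¹ : ℂ) • (Λ (x + y) - Λ (x - y) + Complex.I • Λ (x - Complex.I • y) -
    Complex.I • Λ (x + Complex.I • y)), fun τ => ?_⟩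
  obtain ⟨a, b, hab⟩ := exists_isDyadicSum τ.2
  have h1 := (((((hab.hasSum_trace_comp (Λ (x + y))).sub (hab.hasSum_trace_comp (Λ (x - y)))).add
    ((hab.hasSum_trace_comp (Λ (x - Complex.I • y))).mul_left Complex.I)).sub
    ((hab.hasSum_trace_comp (Λ (x + Complex.I • y))).mul_left Complex.I))).mul_left (4⁻¹ : ℂ)
  have h2 := hab.hasSum_trace_comp ((4⁻¹ : ℂ) • (Λ (x + y) - Λ (x - y) +
    Complex.I • Λ (x - Complex.I • y) - Complex.I • Λ (x + Complex.I • y)))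
  rw [(h2.congr_fun fun k => ?_).unique h1, ← hΛ, ← hΛ, ← hΛ, ← hΛ]
  · simp only [map_add, map_sub, map_smul, inner_add_left, inner_sub_left, inner_add_right,
      inner_sub_right, inner_smul_left, inner_smul_right, Complex.conj_I]
    linear_combination (2⁻¹ * (⟪x, (Φ τ : K →L[ℂ] K) y⟫_ℂ - ⟪y, (Φ τ : K →L[ℂ] K) x⟫_ℂ)) *
      Complex.I_mul_I
  · simp

theorem IsChannel.hasSum_inner {Φ : TraceClass H →ₗ[ℂ] TraceClass K} (hΦ : IsChannel Φ)
    {τ : TraceClass H} {a b : κ → H} (h : IsDyadicSum (τ : H →L[ℂ] H) a b) (x y : K) :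
    HasSum (fun k => ⟪x, (Φ (dyad (a k) (b k)) : K →L[ℂ] K) y⟫_ℂ)
      ⟪x, (Φ τ : K →L[ℂ] K) y⟫_ℂ := by
  obtain ⟨Λ, hΛ⟩ := hΦ.exists_dual x y
  simp only [hΛ, trace_comp_dyad]
  exact h.hasSum_trace_comp Λ

/-- Channels that agree on the matrix units of an orthonormal basis are equal. -/
theorem IsChannel.ext_basis {Φ Ψ : TraceClass H →ₗ[ℂ] TraceClass K} (hΦ : IsChannel Φ)
    (hΨ : IsChannel Ψ) (e : HilbertBasis ι ℂ H)
    (h : ∀ i j, Φ (dyad (e i) (e j)) = Ψ (dyad (e i) (e j))) : Φ = Ψ := by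
  refine LinearMap.ext fun τ => Subtype.ext (ContinuousLinearMap.ext fun y =>
    ext_inner_left ℂ fun x => ?_)
  obtain ⟨Λ, hΛ⟩ := hΦ.exists_dual x y
  obtain ⟨Λ', hΛ'⟩ := hΨ.exists_dual x y
  have hd : Dense (Submodule.span ℂ (Set.range e) : Set H) :=
    Submodule.dense_iff_topologicalClosure_eq_top.2 e.dense_span
  -- The dual operators are bounded, so agreement of their matrix elements in `e` forces equality.
  -- Normality, contained in `IsChannel.exists_dual`, is what makes matrix units suffice.
  have hEq : Λ = Λ' := by
    refine ContinuousLinearMap.ext_on (s := Set.range e) hd ?_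
    rintro _ ⟨i, rfl⟩
    have h1 : innerSL ℂ (Λ (e i) - Λ' (e i)) = 0 := by
      refine ContinuousLinearMap.ext_on (s := Set.range e) hd ?_
      rintro _ ⟨j, rfl⟩
      have h2 := hΛ (dyad (e i) (e j))
      have h3 := hΛ' (dyad (e i) (e j))
      rw [trace_comp_dyad] at h2 h3
      have h4 : ⟪e j, Λ (e i) - Λ' (e i)⟫_ℂ = 0 := by
        rw [inner_sub_right, ← h2, ← h3, h, sub_self]
      exact inner_eq_zero_symm.1 h4
    have h2 := congrArg (fun f : H →L[ℂ] ℂ => f (Λ (e i) - Λ' (e i))) h1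
    exact sub_eq_zero.1 (inner_self_eq_zero.1 h2)
  rw [hΛ, hΛ', hEq]

end Duality

/-! ### Channels defined by Kraus families. -/

section Kraus

open InnerProductSpace (rankOne)

variable {H K κ ι : Type*}
  [NormedAddCommGroup H] [InnerProductSpace ℂ H] [CompleteSpace H]
  [NormedAddCommGroup K] [InnerProductSpace ℂ K] [CompleteSpace K]

theorem ofReal_norm_sq_eq_inner (x : H) : ((‖x‖ ^ 2 : ℝ) : ℂ) = ⟪x, x⟫_ℂ := by
  rw [inner_self_eq_norm_sq_to_K]; push_cast; rfl

/-- Kraus operators of a channel: `∑ₗ Lₗ† Lₗ = I` weakly. -/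
def IsKraus (L : ι → H →L[ℂ] K) : Prop :=
  ∀ x y, HasSum (fun l => ⟪L l x, L l y⟫_ℂ) ⟪x, y⟫_ℂ

variable {L : ι → H →L[ℂ] K}

theorem IsKraus.hasSum_norm_sq (hL : IsKraus L) (x : H) :
    HasSum (fun l => ‖L l x‖ ^ 2) (‖x‖ ^ 2) := by
  have := hL x x
  simp only [← ofReal_norm_sq_eq_inner] at this
  exact Complex.hasSum_ofReal.1 this

theorem IsKraus.summable_norm_sq (hL : IsKraus L) {a : κ → H}
    (ha : Summable fun k => ‖a k‖ ^ 2) : Summable fun p : κ × ι => ‖L p.2 (a p.1)‖ ^ 2 := by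
  refine (summable_prod_of_nonneg fun _ => by positivity).2
    ⟨fun k => (hL.hasSum_norm_sq (a k)).summable, ?_⟩
  simpa only [(hL.hasSum_norm_sq _).tsum_eq] using ha

theorem IsDyadicSum.hasSum_operator {X : H →L[ℂ] H} {a b : κ → H} (h : IsDyadicSum X a b) :
    HasSum (fun k => rankOne ℂ (a k) (b k)) X := by
  rw [h.eq (isDyadicSum_tsum h.left h.right)]
  exact (summable_rankOne h.left h.right).hasSum

/-- The family of all `|Lₗ aₖ⟩⟨Lₗ bₖ|` is absolutely summable in operator norm, so it can be
regrouped by `l`. The resulting sum is again dyadic, hence trace class. -/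
theorem IsKraus.hasSum_operator (hL : IsKraus L) {X : H →L[ℂ] H} {a b : κ → H}
    (h : IsDyadicSum X a b) :
    HasSum (fun l => L l ∘L X ∘L ContinuousLinearMap.adjoint (L l))
      (dyadSum (fun p : κ × ι => L p.2 (a p.1)) (fun p : κ × ι => L p.2 (b p.1))
        (hL.summable_norm_sq h.left) (hL.summable_norm_sq h.right) : K →L[ℂ] K) := by
  have h1 := (summable_rankOne (hL.summable_norm_sq h.left) (hL.summable_norm_sq h.right)).hasSum
  have h2 := (Equiv.prodComm ι κ).hasSum_iff.2 h1
  exact h2.prod_fiberwise fun l => (h.comp (L l) (L l)).hasSum_operator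

theorem IsKraus.summable_operator (hL : IsKraus L) (τ : TraceClass H) :
    Summable fun l => L l ∘L (τ : H →L[ℂ] H) ∘L ContinuousLinearMap.adjoint (L l) := by
  obtain ⟨a, b, h⟩ := exists_isDyadicSum τ.2
  exact (hL.hasSum_operator h).summable

theorem IsKraus.isDyadicSum (hL : IsKraus L) {X : H →L[ℂ] H} {a b : κ → H}
    (h : IsDyadicSum X a b) :
    IsDyadicSum (∑' l, L l ∘L X ∘L ContinuousLinearMap.adjoint (L l))
      (fun p : κ × ι => L p.2 (a p.1)) (fun p : κ × ι => L p.2 (b p.1)) := by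
  rw [(hL.hasSum_operator h).tsum_eq]
  exact isDyadicSum_dyadSum _ _

/-- The map `τ ↦ ∑ₗ Lₗ τ Lₗ†`. -/
def krausMap (L : ι → H →L[ℂ] K) (hL : IsKraus L) : TraceClass H →ₗ[ℂ] TraceClass K where
  toFun τ := ⟨∑' l, L l ∘L (τ : H →L[ℂ] H) ∘L ContinuousLinearMap.adjoint (L l), by
    obtain ⟨a, b, h⟩ := exists_isDyadicSum τ.2
    exact (hL.isDyadicSum h).traceNorm_lt_top⟩
  map_add' σ τ := Subtype.ext <| by
    have := (hL.summable_operator σ).tsum_add (hL.summable_operator τ)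
    simpa using this
  map_smul' c τ := Subtype.ext <| by
    have := (hL.summable_operator τ).tsum_const_smul c
    simpa using this

theorem hasSum_inner_krausMap (hL : IsKraus L) (τ : TraceClass H) (x y : K) :
    HasSum (fun l => ⟪ContinuousLinearMap.adjoint (L l) x,
      (τ : H →L[ℂ] H) (ContinuousLinearMap.adjoint (L l) y)⟫_ℂ)
      ⟪x, (krausMap L hL τ : K →L[ℂ] K) y⟫_ℂ := by
  have := hasSum_inner_apply (hL.summable_operator τ).hasSum x y
  refine this.congr_fun fun l => ?_
  rw [ContinuousLinearMap.adjoint_inner_left]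
  rfl

theorem isChannel_krausMap (hL : IsKraus L) : IsChannel (krausMap L hL) where
  completelyPositive k τ hτ y := by
    have h := hasSum_sum (s := Finset.univ) fun i _ => hasSum_sum (s := Finset.univ) fun j _ =>
      hasSum_inner_krausMap hL (τ i j) (y i) (y j)
    exact h.nonneg fun l => hτ fun i => ContinuousLinearMap.adjoint (L l) (y i)
  tracePreserving τ := by
    obtain ⟨a, b, h⟩ := exists_isDyadicSum τ.2
    have h1 := (hL.isDyadicSum h).hasSum_trace
    have h2 := h1.prod_fiberwise fun k => hL (b k) (a k)
    exact h2.unique h.hasSum_trace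

end Kraus

/-! ### Hilbert tensor products, partial traces and dilations. -/

section Kets

variable {H K S κ ι : Type*}
  [NormedAddCommGroup H] [InnerProductSpace ℂ H] [CompleteSpace H]
  [NormedAddCommGroup K] [InnerProductSpace ℂ K] [CompleteSpace K]
  [NormedAddCommGroup S] [InnerProductSpace ℂ S] [CompleteSpace S]

theorem ketLeft_apply (h : H) (k : K) :
    ketLeft h k = ((h ⊗ₜ[ℂ] k : H ⊗[ℂ] K) : HTensor H K) := rfl

theorem ketRight_apply (h : H) (k : K) :
    ketRight k h = ketLeft h k := rfl

theorem inner_ketLeft (h h' : H) (k k' : K) :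
    ⟪ketLeft h k, ketLeft h' k'⟫_ℂ = ⟪h, h'⟫_ℂ * ⟪k, k'⟫_ℂ := by
  rw [ketLeft_apply, ketLeft_apply, UniformSpace.Completion.inner_coe, TensorProduct.inner_tmul]

theorem eq_zero_of_inner_ketLeft {v : HTensor H K} (h : ∀ x y, ⟪v, ketLeft x y⟫_ℂ = 0) :
    v = 0 := by
  have h1 : ∀ w : HTensor H K, ⟪v, w⟫_ℂ = 0 := by
    intro w
    induction w using UniformSpace.Completion.induction_on with
    | hp => exact isClosed_eq (by fun_prop) continuous_const
    | ih f =>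
      induction f using TensorProduct.induction_on with
      | zero => rw [UniformSpace.Completion.coe_zero, inner_zero_right]
      | tmul x y => exact h x y
      | add f g hf hg => rw [UniformSpace.Completion.coe_add, inner_add_right, hf, hg, add_zero]
  exact inner_self_eq_zero.1 (h1 v)

theorem eq_zero_of_inner_basis (b : HilbertBasis ι ℂ H) {f : H →L[ℂ] ℂ} (h : ∀ i, f (b i) = 0) :
    f = 0 := by
  refine ContinuousLinearMap.ext_on (s := Set.range b)
    (Submodule.dense_iff_topologicalClosure_eq_top.2 b.dense_span) ?_
  rintro _ ⟨j, rfl⟩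
  exact h j

/-- By continuity the vanishing extends from basis vectors to all vectors, one tensor factor at a
time. -/
theorem eq_zero_of_inner_ketLeft_basis (b : HilbertBasis ι ℂ H) (e : HilbertBasis κ ℂ K)
    {v : HTensor H K} (h : ∀ i l, ⟪v, ketLeft (b i) (e l)⟫_ℂ = 0) : v = 0 := by
  refine eq_zero_of_inner_ketLeft fun x y => ?_
  have h1 : ∀ i, ⟪v, ketLeft (b i) y⟫_ℂ = 0 := fun i =>
    congrArg (fun f : K →L[ℂ] ℂ => f y)
      (eq_zero_of_inner_basis e (f := innerSL ℂ v ∘L ketLeft (b i)) (h i))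
  exact congrArg (fun f : H →L[ℂ] ℂ => f x)
    (eq_zero_of_inner_basis b (f := innerSL ℂ v ∘L ketRight y) h1)

theorem orthonormal_ketLeft (b : HilbertBasis ι ℂ H) (e : HilbertBasis κ ℂ K) :
    Orthonormal ℂ fun p : ι × κ => ketLeft (b p.1) (e p.2) := by
  classical
  rw [orthonormal_iff_ite]
  intro p q
  rw [inner_ketLeft, orthonormal_iff_ite.1 b.orthonormal, orthonormal_iff_ite.1 e.orthonormal]
  by_cases h1 : p.1 = q.1 <;> by_cases h2 : p.2 = q.2 <;> simp [h1, h2, Prod.ext_iff]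

/-- The orthonormal basis of product vectors of `H ⊗ K`. -/
def htensorBasis (b : HilbertBasis ι ℂ H) (e : HilbertBasis κ ℂ K) :
    HilbertBasis (ι × κ) ℂ (HTensor H K) :=
  HilbertBasis.mkOfOrthogonalEqBot (orthonormal_ketLeft b e)
    ((Submodule.eq_bot_iff _).2 fun v hv => eq_zero_of_inner_ketLeft_basis b e fun i l =>
      (Submodule.mem_orthogonal' _ v).1 hv _ (Submodule.subset_span ⟨(i, l), rfl⟩))

theorem htensorBasis_apply (b : HilbertBasis ι ℂ H) (e : HilbertBasis κ ℂ K) (p : ι × κ) :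
    htensorBasis b e p = ketLeft (b p.1) (e p.2) :=
  congrFun (HilbertBasis.coe_mkOfOrthogonalEqBot _ _) p

/-- Parseval in the product basis, grouped by the second factor. It is the Kraus condition for the
slices `(I ⊗ ⟨eₗ|)U`. -/
theorem hasSum_inner_ketRight (e : HilbertBasis κ ℂ K) (φ ψ : HTensor H K) :
    HasSum (fun l => ⟪ContinuousLinearMap.adjoint (ketRight (e l)) φ,
      ContinuousLinearMap.adjoint (ketRight (e l)) ψ⟫_ℂ) ⟪φ, ψ⟫_ℂ := by
  have h := (htensorBasis (onb H) e).hasSum_inner_mul_inner φ ψ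
  have h1 := (Equiv.prodComm κ (basisIndex H)).hasSum_iff.2 h
  refine h1.prod_fiberwise fun l => ?_
  have h2 := (onb H).hasSum_inner_mul_inner (ContinuousLinearMap.adjoint (ketRight (e l)) φ)
    (ContinuousLinearMap.adjoint (ketRight (e l)) ψ)
  refine h2.congr_fun fun i => ?_
  rw [ContinuousLinearMap.adjoint_inner_left, ContinuousLinearMap.adjoint_inner_right]
  simp [htensorBasis_apply, ketRight_apply]

theorem hasSum_inner_adjoint_ketLeft (b : HilbertBasis ι ℂ H) (φ ψ : HTensor H K) :
    HasSum (fun l => ⟪ContinuousLinearMap.adjoint (ketLeft (b l)) φ,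
      ContinuousLinearMap.adjoint (ketLeft (b l)) ψ⟫_ℂ) ⟪φ, ψ⟫_ℂ := by
  have h := (htensorBasis b (onb K)).hasSum_inner_mul_inner φ ψ
  refine h.prod_fiberwise fun l => ?_
  have h2 := (onb K).hasSum_inner_mul_inner (ContinuousLinearMap.adjoint (ketLeft (b l)) φ)
    (ContinuousLinearMap.adjoint (ketLeft (b l)) ψ)
  refine h2.congr_fun fun i => ?_
  rw [ContinuousLinearMap.adjoint_inner_left, ContinuousLinearMap.adjoint_inner_right]
  simp [htensorBasis_apply]

theorem isKraus_right (U : H →ₗᵢ[ℂ] HTensor K S) (e : HilbertBasis ι ℂ S) :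
    IsKraus fun l => ContinuousLinearMap.adjoint (ketRight (e l)) ∘L U.toContinuousLinearMap :=
  fun x y => by
    have := hasSum_inner_ketRight e (U x) (U y)
    rwa [U.inner_map_map] at this

theorem isKraus_left (U : H →ₗᵢ[ℂ] HTensor K S) (b : HilbertBasis ι ℂ K) :
    IsKraus fun l => ContinuousLinearMap.adjoint (ketLeft (b l)) ∘L U.toContinuousLinearMap :=
  fun x y => by
    have := hasSum_inner_adjoint_ketLeft b (U x) (U y)
    rwa [U.inner_map_map] at this

/-- The channel `τ ↦ Tr_S (U τ U†)`, with the partial trace evaluated in the basis `e`. -/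
def channelRight (U : H →ₗᵢ[ℂ] HTensor K S) (e : HilbertBasis ι ℂ S) :
    TraceClass H →ₗ[ℂ] TraceClass K := krausMap _ (isKraus_right U e)

/-- The channel `τ ↦ Tr_K (U τ U†)`, with the partial trace evaluated in the basis `b`. -/
def channelLeft (U : H →ₗᵢ[ℂ] HTensor K S) (b : HilbertBasis ι ℂ K) :
    TraceClass H →ₗ[ℂ] TraceClass S := krausMap _ (isKraus_left U b)

theorem isChannel_channelRight (U : H →ₗᵢ[ℂ] HTensor K S) (e : HilbertBasis ι ℂ S) :
    IsChannel (channelRight U e) := isChannel_krausMap _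

theorem isChannel_channelLeft (U : H →ₗᵢ[ℂ] HTensor K S) (b : HilbertBasis ι ℂ K) :
    IsChannel (channelLeft U b) := isChannel_krausMap _

theorem hasSum_inner_channelRight (U : H →ₗᵢ[ℂ] HTensor K S) (e : HilbertBasis ι ℂ S)
    (τ : TraceClass H) (x y : K) :
    HasSum (fun l => ⟪ContinuousLinearMap.adjoint U.toContinuousLinearMap (ketLeft x (e l)),
      (τ : H →L[ℂ] H) (ContinuousLinearMap.adjoint U.toContinuousLinearMap (ketLeft y (e l)))⟫_ℂ)
      ⟪x, (channelRight U e τ : K →L[ℂ] K) y⟫_ℂ := by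
  have := hasSum_inner_krausMap (isKraus_right U e) τ x y
  simp only [ContinuousLinearMap.adjoint_comp, ContinuousLinearMap.adjoint_adjoint] at this
  exact this

theorem hasSum_inner_channelLeft (U : H →ₗᵢ[ℂ] HTensor K S) (b : HilbertBasis ι ℂ K)
    (τ : TraceClass H) (x y : S) :
    HasSum (fun l => ⟪ContinuousLinearMap.adjoint U.toContinuousLinearMap (ketLeft (b l) x),
      (τ : H →L[ℂ] H) (ContinuousLinearMap.adjoint U.toContinuousLinearMap (ketLeft (b l) y))⟫_ℂ)
      ⟪x, (channelLeft U b τ : S →L[ℂ] S) y⟫_ℂ := by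
  have := hasSum_inner_krausMap (isKraus_left U b) τ x y
  simp only [ContinuousLinearMap.adjoint_comp, ContinuousLinearMap.adjoint_adjoint] at this
  exact this

/-- Parseval in the environment removes the basis `e` from the right-hand side. This yields both the
independence of the partial trace from the basis and, later, the environment vectors. -/
theorem inner_channelRight_dyad (U : H →ₗᵢ[ℂ] HTensor K S) (e : HilbertBasis ι ℂ S)
    (a b : H) (x y : K) :
    ⟪x, (channelRight U e (dyad a b) : K →L[ℂ] K) y⟫_ℂ =
      ⟪ContinuousLinearMap.adjoint (ketLeft y) (U b),
        ContinuousLinearMap.adjoint (ketLeft x) (U a)⟫_ℂ := by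
  refine (hasSum_inner_channelRight U e (dyad a b) x y).unique ?_
  have := e.hasSum_inner_mul_inner (ContinuousLinearMap.adjoint (ketLeft y) (U b))
    (ContinuousLinearMap.adjoint (ketLeft x) (U a))
  refine this.congr_fun fun l => ?_
  simp only [coe_dyad, InnerProductSpace.rankOne_apply, inner_smul_right,
    ContinuousLinearMap.adjoint_inner_left, ContinuousLinearMap.adjoint_inner_right]
  rfl

theorem inner_channelLeft_dyad (U : H →ₗᵢ[ℂ] HTensor K S) (e : HilbertBasis ι ℂ K)
    (a b : H) (x y : S) :
    ⟪x, (channelLeft U e (dyad a b) : S →L[ℂ] S) y⟫_ℂ =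
      ⟪ContinuousLinearMap.adjoint (ketRight y) (U b),
        ContinuousLinearMap.adjoint (ketRight x) (U a)⟫_ℂ := by
  refine (hasSum_inner_channelLeft U e (dyad a b) x y).unique ?_
  have := e.hasSum_inner_mul_inner (ContinuousLinearMap.adjoint (ketRight y) (U b))
    (ContinuousLinearMap.adjoint (ketRight x) (U a))
  refine this.congr_fun fun l => ?_
  simp only [coe_dyad, InnerProductSpace.rankOne_apply, inner_smul_right,
    ContinuousLinearMap.adjoint_inner_left, ContinuousLinearMap.adjoint_inner_right]
  rfl

theorem ext_inner_operator {X Y : H →L[ℂ] H} (h : ∀ x y, ⟪x, X y⟫_ℂ = ⟪x, Y y⟫_ℂ) : X = Y :=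
  ContinuousLinearMap.ext fun y => ext_inner_left ℂ fun x => h x y

theorem channelRight_eq (U : H →ₗᵢ[ℂ] HTensor K S) (e : HilbertBasis ι ℂ S)
    (e' : HilbertBasis κ ℂ S) : channelRight U e = channelRight U e' :=
  (isChannel_channelRight U e).ext_basis (isChannel_channelRight U e') (onb H) fun i j =>
    Subtype.ext <| ext_inner_operator fun x y => by
      rw [inner_channelRight_dyad, inner_channelRight_dyad]

theorem channelLeft_eq (U : H →ₗᵢ[ℂ] HTensor K S) (e : HilbertBasis ι ℂ K)
    (e' : HilbertBasis κ ℂ K) : channelLeft U e = channelLeft U e' :=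
  (isChannel_channelLeft U e).ext_basis (isChannel_channelLeft U e') (onb H) fun i j =>
    Subtype.ext <| ext_inner_operator fun x y => by
      rw [inner_channelLeft_dyad, inner_channelLeft_dyad]

theorem coe_channelRight (U : H →ₗᵢ[ℂ] HTensor K S) (τ : TraceClass H) :
    (channelRight U (onb S) τ : K →L[ℂ] K) = partialTraceRight (U.toContinuousLinearMap ∘L
      (τ : H →L[ℂ] H) ∘L ContinuousLinearMap.adjoint U.toContinuousLinearMap) := by
  refine tsum_congr fun l => ?_
  rw [ContinuousLinearMap.adjoint_comp, ContinuousLinearMap.adjoint_adjoint]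
  rfl

theorem coe_channelLeft (U : H →ₗᵢ[ℂ] HTensor K S) (τ : TraceClass H) :
    (channelLeft U (onb K) τ : S →L[ℂ] S) = partialTraceLeft (U.toContinuousLinearMap ∘L
      (τ : H →L[ℂ] H) ∘L ContinuousLinearMap.adjoint U.toContinuousLinearMap) := by
  refine tsum_congr fun l => ?_
  rw [ContinuousLinearMap.adjoint_comp, ContinuousLinearMap.adjoint_adjoint]
  rfl

theorem IsComplementary.exists_isometry {N : TraceClass H →ₗ[ℂ] TraceClass K}
    {N' : TraceClass H →ₗ[ℂ] TraceClass S} (h : IsComplementary N N') :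
    ∃ U : H →ₗᵢ[ℂ] HTensor K S, N = channelRight U (onb S) ∧ N' = channelLeft U (onb K) := by
  obtain ⟨U, hU⟩ := h
  exact ⟨U, LinearMap.ext fun τ => Subtype.ext ((hU τ).1.trans (coe_channelRight U τ).symm),
    LinearMap.ext fun τ => Subtype.ext ((hU τ).2.trans (coe_channelLeft U τ).symm)⟩

end Kets

/-! ### Tensor powers of dilations and of channels. -/

section TensorPowers

variable {H K S κ ι : Type*} {n : ℕ}
  [NormedAddCommGroup H] [InnerProductSpace ℂ H] [CompleteSpace H]
  [NormedAddCommGroup K] [InnerProductSpace ℂ K] [CompleteSpace K]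
  [NormedAddCommGroup S] [InnerProductSpace ℂ S] [CompleteSpace S]

/-- The isometry that maps an orthonormal basis to a given orthonormal family. -/
def isometryOfOrthonormal (b : HilbertBasis ι ℂ H) {v : ι → K} (hv : Orthonormal ℂ v) :
    H →ₗᵢ[ℂ] K :=
  hv.orthogonalFamily.linearIsometry.comp b.repr.toLinearIsometry

theorem isometryOfOrthonormal_apply (b : HilbertBasis ι ℂ H) {v : ι → K} (hv : Orthonormal ℂ v)
    (i : ι) : isometryOfOrthonormal b hv (b i) = v i := by
  classical
  change hv.orthogonalFamily.linearIsometry (b.repr (b i)) = v i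
  rw [b.repr_self, hv.orthogonalFamily.linearIsometry_apply_single]
  simp

theorem ext_inner_basis (b : HilbertBasis ι ℂ H) {v w : H} (h : ∀ i, ⟪b i, v⟫_ℂ = ⟪b i, w⟫_ℂ) :
    v = w := by
  have h1 : innerSL ℂ (v - w) = 0 := eq_zero_of_inner_basis b fun i => by
    refine inner_eq_zero_symm.1 ?_
    rw [inner_sub_right, h, sub_self]
  have h2 := congrArg (fun f : H →L[ℂ] ℂ => f (v - w)) h1
  exact sub_eq_zero.1 (inner_self_eq_zero.1 h2)

theorem tpowBasis_apply (b : HilbertBasis ι ℂ H) (J : Fin n → ι) :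
    tpowBasis n b J = tprod fun i => b (J i) :=
  congrFun (HilbertBasis.coe_mkOfOrthogonalEqBot _ _) J

theorem orthonormal_tprod_isometry (U : H →ₗᵢ[ℂ] K) (b : HilbertBasis ι ℂ H) :
    Orthonormal ℂ fun J : Fin n → ι => tprod fun i => U (b (J i)) :=
  orthonormal_tprod (b.orthonormal.comp_linearIsometry U)

/-- The tensor power `U ⊗ ⋯ ⊗ U` of an isometry. -/
def tpowIsometry (n : ℕ) (U : H →ₗᵢ[ℂ] K) : TPow n H →ₗᵢ[ℂ] TPow n K :=
  isometryOfOrthonormal (tpowBasis n (onb H)) (orthonormal_tprod_isometry U (onb H))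

/-- `tpowIsometry` is specified only on a basis; testing against that basis gives its adjoint on all
product vectors. Matrix elements of the dilated channels involve the isometry only through its
adjoint. -/
theorem adjoint_tpowIsometry_tprod (U : H →ₗᵢ[ℂ] K) (y : Fin n → K) :
    ContinuousLinearMap.adjoint (tpowIsometry n U).toContinuousLinearMap (tprod y) =
      tprod fun i => ContinuousLinearMap.adjoint U.toContinuousLinearMap (y i) := by
  refine ext_inner_basis (tpowBasis n (onb H)) fun J => ?_
  have h : tpowIsometry n U (tpowBasis n (onb H) J) = _ := isometryOfOrthonormal_apply _ _ J
  rw [ContinuousLinearMap.adjoint_inner_right, LinearIsometry.coe_toContinuousLinearMap, h,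
    tpowBasis_apply, inner_tprod, inner_tprod]
  refine Finset.prod_congr rfl fun i _ => ?_
  rw [ContinuousLinearMap.adjoint_inner_right]
  rfl

theorem orthonormal_shuffle (b : HilbertBasis ι ℂ H) (e : HilbertBasis κ ℂ K) :
    Orthonormal ℂ fun P : Fin n → ι × κ =>
      ketLeft (tprod fun i => b (P i).1) (tprod fun i => e (P i).2) := by
  classical
  rw [orthonormal_iff_ite]
  intro P Q
  rw [inner_ketLeft, inner_tprod, inner_tprod, ← Finset.prod_mul_distrib]
  have := orthonormal_iff_ite.1 (orthonormal_tprod (n := n) (htensorBasis b e).orthonormal) P Q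
  simpa only [inner_tprod, htensorBasis_apply, inner_ketLeft] using this

/-- The isometry `(H ⊗ K) ⊗ ⋯ ⊗ (H ⊗ K) → (H ⊗ ⋯ ⊗ H) ⊗ (K ⊗ ⋯ ⊗ K)`. -/
def shuffle (n : ℕ) (H K : Type*) [NormedAddCommGroup H] [InnerProductSpace ℂ H] [CompleteSpace H]
    [NormedAddCommGroup K] [InnerProductSpace ℂ K] [CompleteSpace K] :
    TPow n (HTensor H K) →ₗᵢ[ℂ] HTensor (TPow n H) (TPow n K) :=
  isometryOfOrthonormal (tpowBasis n (htensorBasis (onb H) (onb K)))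
    (orthonormal_shuffle (onb H) (onb K))

theorem adjoint_shuffle_ketLeft (x : Fin n → H) (y : Fin n → K) :
    ContinuousLinearMap.adjoint (shuffle n H K).toContinuousLinearMap
      (ketLeft (tprod x) (tprod y)) = tprod fun i => ketLeft (x i) (y i) := by
  refine ext_inner_basis (tpowBasis n (htensorBasis (onb H) (onb K))) fun P => ?_
  have h : shuffle n H K (tpowBasis n (htensorBasis (onb H) (onb K)) P) = _ :=
    isometryOfOrthonormal_apply _ _ P
  rw [ContinuousLinearMap.adjoint_inner_right, LinearIsometry.coe_toContinuousLinearMap, h,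
    tpowBasis_apply, inner_ketLeft, inner_tprod, inner_tprod, inner_tprod,
    ← Finset.prod_mul_distrib]
  simp only [htensorBasis_apply, inner_ketLeft]

/-- The tensor power of a dilation isometry, with the output systems grouped together. -/
def tpowDilation (n : ℕ) (U : H →ₗᵢ[ℂ] HTensor K S) :
    TPow n H →ₗᵢ[ℂ] HTensor (TPow n K) (TPow n S) :=
  (shuffle n K S).comp (tpowIsometry n U)

theorem adjoint_tpowDilation_ketLeft (U : H →ₗᵢ[ℂ] HTensor K S) (x : Fin n → K) (y : Fin n → S) :
    ContinuousLinearMap.adjoint (tpowDilation n U).toContinuousLinearMap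
      (ketLeft (tprod x) (tprod y)) =
      tprod fun i => ContinuousLinearMap.adjoint U.toContinuousLinearMap (ketLeft (x i) (y i)) := by
  have h : (tpowDilation n U).toContinuousLinearMap =
    (shuffle n K S).toContinuousLinearMap ∘L (tpowIsometry n U).toContinuousLinearMap := rfl
  rw [h, ContinuousLinearMap.adjoint_comp, ContinuousLinearMap.comp_apply,
    adjoint_shuffle_ketLeft, adjoint_tpowIsometry_tprod]

theorem hasSum_mul_prod {f : ι → ℂ} {g : κ → ℂ} {a b : ℂ} (hf : HasSum f a) (hg : HasSum g b) :
    HasSum (fun p : ι × κ => f p.1 * g p.2) (a * b) :=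
  hf.mul hg (summable_mul_of_summable_norm hf.summable.norm hg.summable.norm)

theorem hasSum_prod_pi {f : Fin n → ι → ℂ} {a : Fin n → ℂ} (h : ∀ i, HasSum (f i) (a i)) :
    HasSum (fun J : Fin n → ι => ∏ i, f i (J i)) (∏ i, a i) := by
  induction n with
  | zero => simp
  | succ n ih =>
    have h1 := ih fun i => h i.succ
    have h2 := hasSum_mul_prod (h 0) h1
    rw [Fin.prod_univ_succ, ← (Fin.consEquiv fun _ => ι).hasSum_iff]
    refine h2.congr_fun fun p => ?_
    simp [Fin.prod_univ_succ, Fin.consEquiv]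

theorem isProductOp_iff {T : Fin n → H →L[ℂ] H} {X : TPow n H →L[ℂ] TPow n H} :
    IsProductOp T X ↔ ∀ x y, ⟪tprod x, X (tprod y)⟫_ℂ = ∏ i, ⟪x i, T i (y i)⟫_ℂ := by
  refine ⟨fun h x y => ?_, fun h y => ext_inner_tprod fun x => ?_⟩
  · rw [h y, inner_tprod]
  · rw [h, inner_tprod]

/-- Tracing out the environment in the product basis makes the matrix elements between product
vectors a series over tuples, which factors into the `n` single-channel series by `hasSum_prod_pi`.
-/
theorem isTensorPower_channelRight (n : ℕ) (U : H →ₗᵢ[ℂ] HTensor K S) :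
    IsTensorPower n (channelRight U (onb S))
      (channelRight (tpowDilation n U) (tpowBasis n (onb S))) where
  isChannel := isChannel_channelRight _ _
  map_product τ ρ h := isProductOp_iff.2 fun x y => by
    refine (hasSum_inner_channelRight _ _ ρ _ _).unique ?_
    refine (hasSum_prod_pi fun i => hasSum_inner_channelRight U (onb S) (τ i) (x i) (y i)).congr_fun
      fun J => ?_
    rw [tpowBasis_apply, adjoint_tpowDilation_ketLeft, adjoint_tpowDilation_ketLeft,
      isProductOp_iff.1 h]

theorem isTensorPower_channelLeft (n : ℕ) (U : H →ₗᵢ[ℂ] HTensor K S) :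
    IsTensorPower n (channelLeft U (onb K))
      (channelLeft (tpowDilation n U) (tpowBasis n (onb K))) where
  isChannel := isChannel_channelLeft _ _
  map_product τ ρ h := isProductOp_iff.2 fun x y => by
    refine (hasSum_inner_channelLeft _ _ ρ _ _).unique ?_
    refine (hasSum_prod_pi fun i => hasSum_inner_channelLeft U (onb K) (τ i) (x i) (y i)).congr_fun
      fun J => ?_
    rw [tpowBasis_apply, adjoint_tpowDilation_ketLeft, adjoint_tpowDilation_ketLeft,
      isProductOp_iff.1 h]

theorem isProductOp_dyad (x y : Fin n → H) :
    IsProductOp (fun i => (dyad (x i) (y i) : H →L[ℂ] H))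
      (dyad (tprod x) (tprod y) : TPow n H →L[ℂ] TPow n H) := isProductOp_iff.2 fun z w => by
  simp only [coe_dyad, InnerProductSpace.rankOne_apply, inner_smul_right, inner_tprod,
    Finset.prod_mul_distrib]

theorem IsProductOp.eq {T : Fin n → H →L[ℂ] H} {X Y : TPow n H →L[ℂ] TPow n H}
    (hX : IsProductOp T X) (hY : IsProductOp T Y) : X = Y := by
  refine ContinuousLinearMap.ext_on (s := Set.range (tpowBasis n (onb H)))
    (Submodule.dense_iff_topologicalClosure_eq_top.2 (tpowBasis n (onb H)).dense_span) ?_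
  rintro _ ⟨J, rfl⟩
  rw [tpowBasis_apply, hX, hY]

/-- Matrix units of a product basis are product operators, on which the values are prescribed;
`IsChannel.ext_basis` does the rest. -/
theorem IsTensorPower.unique {N : TraceClass H →ₗ[ℂ] TraceClass K}
    {Φ Ψ : TraceClass (TPow n H) →ₗ[ℂ] TraceClass (TPow n K)} (hΦ : IsTensorPower n N Φ)
    (hΨ : IsTensorPower n N Ψ) : Φ = Ψ := by
  refine hΦ.isChannel.ext_basis hΨ.isChannel (tpowBasis n (onb H)) fun I J => Subtype.ext ?_
  rw [tpowBasis_apply, tpowBasis_apply]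
  exact (hΦ.map_product _ _ (isProductOp_dyad _ _)).eq (hΨ.map_product _ _ (isProductOp_dyad _ _))

theorem IsTensorPower.tensorPower_eq {N : TraceClass H →ₗ[ℂ] TraceClass K}
    {Φ : TraceClass (TPow n H) →ₗ[ℂ] TraceClass (TPow n K)} (hΦ : IsTensorPower n N Φ) :
    tensorPower n N = Φ := by
  have h : ∃ Φ, IsTensorPower n N Φ := ⟨Φ, hΦ⟩
  rw [tensorPower, dif_pos h]
  exact h.choose_spec.unique hΦ

/-- Tensor powers of complementary channels have a common dilation. -/
theorem IsComplementary.exists_isometry_tensorPower {N : TraceClass H →ₗ[ℂ] TraceClass K}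
    {N' : TraceClass H →ₗ[ℂ] TraceClass S} (h : IsComplementary N N') (n : ℕ) :
    ∃ U : TPow n H →ₗᵢ[ℂ] HTensor (TPow n K) (TPow n S),
      tensorPower n N = channelRight U (onb (TPow n S)) ∧
      tensorPower n N' = channelLeft U (onb (TPow n K)) := by
  obtain ⟨U, rfl, rfl⟩ := h.exists_isometry
  refine ⟨tpowDilation n U, ?_, ?_⟩
  · rw [(isTensorPower_channelRight n U).tensorPower_eq, channelRight_eq]
  · rw [(isTensorPower_channelLeft n U).tensorPower_eq, channelLeft_eq]

end TensorPowers

/-! ### Gram decompositions of the encoder and the decoder. -/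

section Gram

variable {H K κ ν ι : Type*} {M : ℕ}
  [NormedAddCommGroup H] [InnerProductSpace ℂ H] [CompleteSpace H]
  [NormedAddCommGroup K] [InnerProductSpace ℂ K] [CompleteSpace K]

/-- The Hilbert space direct sum of `M` copies of `H`. -/
abbrev DirectPow (M : ℕ) (H : Type*) [NormedAddCommGroup H] [InnerProductSpace ℂ H] : Type _ :=
  PiLp 2 fun _ : Fin M => H

theorem adjoint_proj_apply (j : Fin M) (x : H) :
    ContinuousLinearMap.adjoint (PiLp.proj (𝕜 := ℂ) 2 (fun _ : Fin M => H) j) x =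
      WithLp.toLp 2 (Pi.single j x) := by
  classical
  refine ext_inner_right ℂ fun z => ?_
  rw [ContinuousLinearMap.adjoint_inner_left, PiLp.inner_apply,
    Finset.sum_eq_single_of_mem j (Finset.mem_univ j)]
  · simp
  · intro i _ hi
    simp [Pi.single_eq_of_ne hi]

/-- A positive semi-definite operator matrix is `Tᵢⱼ = ∑ₖ |gₖᵢ⟩⟨gₖⱼ|`. -/
theorem exists_gram {T : Fin M → Fin M → H →L[ℂ] H}
    (hT : ∀ x : Fin M → H, 0 ≤ ∑ i, ∑ j, ⟪x i, T i j (x j)⟫_ℂ) :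
    ∃ g : basisIndex (DirectPow M H) → Fin M → H, ∀ i j y x,
      HasSum (fun k => ⟪y, g k i⟫_ℂ * ⟪g k j, x⟫_ℂ) ⟪y, T i j x⟫_ℂ := by
  let π : Fin M → DirectPow M H →L[ℂ] H := PiLp.proj (𝕜 := ℂ) 2 (fun _ : Fin M => H)
  -- The operator matrix becomes one positive operator on the direct sum; expanding `⟨R·, R·⟩` for
  -- its square root `R` in a basis gives the Gram vectors.
  let X : DirectPow M H →L[ℂ] DirectPow M H :=
    ∑ i, ∑ j, ContinuousLinearMap.adjoint (π i) ∘L T i j ∘L π j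
  have hX : ∀ z w : DirectPow M H, ⟪z, X w⟫_ℂ = ∑ i, ∑ j, ⟪π i z, T i j (π j w)⟫_ℂ := by
    intro z w
    simp only [X, sum_apply, inner_sum, ContinuousLinearMap.comp_apply,
      ContinuousLinearMap.adjoint_inner_right]
  have hpos : X.IsPositive := isPositive_of_inner_nonneg fun z => by
    rw [hX]
    exact hT fun i => π i z
  obtain ⟨R, hR, hRR⟩ := exists_sqrt hpos
  have hπ : ∀ i j x, π i (ContinuousLinearMap.adjoint (π j) x) =
      (Pi.single j x : Fin M → H) i := fun i j x =>
    congrArg (π i) (adjoint_proj_apply j x)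
  have hTX : ∀ i j y x, ⟪y, T i j x⟫_ℂ =
      ⟪ContinuousLinearMap.adjoint (π i) y, X (ContinuousLinearMap.adjoint (π j) x)⟫_ℂ := by
    intro i j y x
    rw [hX, Finset.sum_eq_single_of_mem i (Finset.mem_univ i),
      Finset.sum_eq_single_of_mem j (Finset.mem_univ j)]
    · simp [hπ]
    · intro k _ hk
      simp [hπ, Pi.single_eq_of_ne hk]
    · intro k _ hk
      refine Finset.sum_eq_zero fun l _ => ?_
      simp [hπ, Pi.single_eq_of_ne hk]
  refine ⟨fun k i => π i (R (onb (DirectPow M H) k)), fun i j y x => ?_⟩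
  rw [hTX, inner_eq_inner_sqrt hR hRR]
  refine ((onb (DirectPow M H)).hasSum_inner_mul_inner _ _).congr_fun fun k => ?_
  congr 1
  · rw [← ContinuousLinearMap.adjoint_inner_left, ← ContinuousLinearMap.adjoint_inner_left, hR]
  · rw [← ContinuousLinearMap.adjoint_inner_right, ← ContinuousLinearMap.adjoint_inner_right, hR]

theorem sum_inner_dyad_nonneg (v x : Fin M → H) :
    0 ≤ ∑ i, ∑ j, ⟪x i, (dyad (v i) (v j) : H →L[ℂ] H) (x j)⟫_ℂ := by
  have h : ∑ i, ∑ j, ⟪x i, (dyad (v i) (v j) : H →L[ℂ] H) (x j)⟫_ℂ =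
      (∑ i, ⟪x i, v i⟫_ℂ) * starRingEnd ℂ (∑ i, ⟪x i, v i⟫_ℂ) := by
    rw [map_sum, Finset.sum_mul_sum]
    refine Finset.sum_congr rfl fun i _ => Finset.sum_congr rfl fun j _ => ?_
    rw [inner_conj_symm, coe_dyad, InnerProductSpace.rankOne_apply, inner_smul_right, mul_comm]
  rw [h, Complex.mul_conj]
  exact Complex.zero_le_real.2 (Complex.normSq_nonneg _)

theorem inner_mul_inner_symm (x y : H) : ⟪x, y⟫_ℂ * ⟪y, x⟫_ℂ = ((‖⟪x, y⟫_ℂ‖ ^ 2 : ℝ) : ℂ) := by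
  rw [← inner_conj_symm y x, Complex.mul_conj, Complex.normSq_eq_norm_sq]

theorem hasSum_norm_sq_of_gram {a : κ → H} {x : H} {c : ℂ}
    (h : HasSum (fun k => ⟪x, a k⟫_ℂ * ⟪a k, x⟫_ℂ) c) :
    HasSum (fun k => ‖⟪x, a k⟫_ℂ‖ ^ 2) c.re := by
  have := Complex.hasSum_re h
  simpa only [inner_mul_inner_symm, Complex.ofReal_re] using this

/-- A positive dyadic sum that is trace class is square summable. -/
theorem summable_norm_sq_of_traceClass {τ : TraceClass H} {a : κ → H}
    (h : ∀ y, HasSum (fun k => ⟪y, a k⟫_ℂ * ⟪a k, y⟫_ℂ) ⟪y, (τ : H →L[ℂ] H) y⟫_ℂ) :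
    Summable fun k => ‖a k‖ ^ 2 := by
  -- Tonelli: summing `|⟨eᵢ, aₖ⟩|²` over `k` gives `⟨eᵢ, τ eᵢ⟩`, and over `i` then the finite trace;
  -- the other order gives `∑ₖ ‖aₖ‖²`.
  have h1 : ∀ i, HasSum (fun k => ‖⟪onb H i, a k⟫_ℂ‖ ^ 2) _ := fun i =>
    hasSum_norm_sq_of_gram (h (onb H i))
  have h2 : Summable fun p : basisIndex H × κ => ‖⟪onb H p.1, a p.2⟫_ℂ‖ ^ 2 := by
    refine (summable_prod_of_nonneg fun _ => by positivity).2 ⟨fun i => (h1 i).summable, ?_⟩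
    simp only [(h1 _).tsum_eq]
    exact (Complex.hasSum_re (hasSum_trace_basis (onb H) τ)).summable
  have h3 := (Equiv.prodComm κ (basisIndex H)).summable_iff.2 h2
  have h4 := ((summable_prod_of_nonneg fun _ => by dsimp; positivity).1 h3).2
  refine h4.congr fun k => ?_
  exact (hasSum_norm_sq_inner (onb H) (a k)).tsum_eq

/-- Kraus operators of a channel with input `ℂᴹ`. -/
theorem IsCompletelyPositive.exists_encoder
    {C : TraceClass (EuclideanSpace ℂ (Fin M)) →ₗ[ℂ] TraceClass H} (hC : IsCompletelyPositive C) :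
    ∃ a : basisIndex (DirectPow M H) → Fin M → H, ∀ i j,
      IsDyadicSum
        (C (dyad (EuclideanSpace.single i (1 : ℂ)) (EuclideanSpace.single j (1 : ℂ))) : H →L[ℂ] H)
        (fun k => a k i) (fun k => a k j) := by
  obtain ⟨a, ha⟩ := exists_gram (T := fun i j =>
    (C (dyad (EuclideanSpace.single i (1 : ℂ)) (EuclideanSpace.single j (1 : ℂ))) : H →L[ℂ] H))
    (hC M _ (sum_inner_dyad_nonneg fun i => EuclideanSpace.single i 1))
  have hs : ∀ i, Summable fun k => ‖a k i‖ ^ 2 := fun i =>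
    summable_norm_sq_of_traceClass fun y => ha i i y y
  exact ⟨a, fun i j => ⟨hs i, hs j, ha i j⟩⟩

/-- For a decoder the vectors `gₗ` need not be square summable, since `Λ` is only bounded. Still `∑ₗ
|⟨a, gₗ⟩|² = ⟨a, Λa⟩ ≤ ‖Λ‖‖a‖²`, which is enough to interchange sums against a square-summable
family. -/
theorem summable_prod_norm_sq_gram {g : κ → H} {Λ : H →L[ℂ] H}
    (hg : ∀ y x, HasSum (fun k => ⟪y, g k⟫_ℂ * ⟪g k, x⟫_ℂ) ⟪y, Λ x⟫_ℂ) {a : ν → H}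
    (ha : Summable fun k => ‖a k‖ ^ 2) :
    Summable fun p : ν × κ => ‖⟪a p.1, g p.2⟫_ℂ‖ ^ 2 := by
  have h1 : ∀ k, HasSum (fun l => ‖⟪a k, g l⟫_ℂ‖ ^ 2) _ := fun k =>
    hasSum_norm_sq_of_gram (hg (a k) (a k))
  refine (summable_prod_of_nonneg fun _ => by positivity).2 ⟨fun k => (h1 k).summable, ?_⟩
  simp only [(h1 _).tsum_eq]
  refine Summable.of_nonneg_of_le (fun k => (h1 k).nonneg fun _ => by positivity) (fun k => ?_)
    (ha.mul_left ‖Λ‖)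
  refine (Complex.re_le_norm _).trans ((norm_inner_le_norm _ _).trans ?_)
  nlinarith [Λ.le_opNorm (a k), norm_nonneg (a k)]

/-- The Heisenberg picture of a channel with output `ℂᴹ`. -/
theorem IsChannel.exists_decoder
    {D : TraceClass H →ₗ[ℂ] TraceClass (EuclideanSpace ℂ (Fin M))} (hD : IsChannel D) :
    ∃ (g : basisIndex (DirectPow M H) → Fin M → H) (Λ : Fin M → H →L[ℂ] H),
      IsPOVM Λ ∧
      (∀ m y x, HasSum (fun l => ⟪y, g l m⟫_ℂ * ⟪g l m, x⟫_ℂ) ⟪y, Λ m x⟫_ℂ) ∧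
      (∀ m (τ : TraceClass H), trace (Λ m ∘L (τ : H →L[ℂ] H)) =
        ⟪EuclideanSpace.single m (1 : ℂ), (D τ : _ →L[ℂ] _) (EuclideanSpace.single m (1 : ℂ))⟫_ℂ) ∧
      ∀ i j (τ : TraceClass H), HasSum (fun l => ⟪g l i, (τ : H →L[ℂ] H) (g l j)⟫_ℂ)
        ⟪EuclideanSpace.single i (1 : ℂ),
          (D τ : _ →L[ℂ] _) (EuclideanSpace.single j (1 : ℂ))⟫_ℂ := by
  choose Λ hΛ using fun i j : Fin M =>
    hD.exists_dual (EuclideanSpace.single i (1 : ℂ)) (EuclideanSpace.single j (1 : ℂ))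
  have hΛd : ∀ i j a b, ⟪b, Λ i j a⟫_ℂ = ⟪EuclideanSpace.single i (1 : ℂ),
      (D (dyad a b) : _ →L[ℂ] _) (EuclideanSpace.single j (1 : ℂ))⟫_ℂ := fun i j a b => by
    rw [hΛ, trace_comp_dyad]
  -- The indices are transposed: `⟨b, Λᵢⱼ a⟩ = ⟨i|D(|a⟩⟨b|)|j⟩`, so complete positivity of `D` makes
  -- the matrix with entry `Λᵢⱼ` at `(j, i)` positive, whence `Λᵢⱼ = ∑ₗ |gₗⱼ⟩⟨gₗᵢ|`.
  obtain ⟨g, hg⟩ := exists_gram (T := fun j i => Λ i j) fun x => by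
    have := hD.completelyPositive M _ (sum_inner_dyad_nonneg x)
      fun i => EuclideanSpace.single i (1 : ℂ)
    simp only [← hΛd] at this
    rwa [Finset.sum_comm]
  refine ⟨g, fun m => Λ m m, ⟨fun m => isPositive_of_inner_nonneg fun x => ?_, ?_⟩,
    fun m => hg m m, fun m τ => (hΛ m m τ).symm, fun i j τ => ?_⟩
  · rw [hΛd]
    exact (hD.completelyPositive.isPositive (isPositive_dyad_self x)).inner_nonneg_right _
  -- Trace preservation of `D` on dyads is the completeness of the POVM.
  · refine ext_inner_operator fun x y => ?_
    rw [sum_apply, inner_sum]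
    simp only [hΛd, ContinuousLinearMap.id_apply]
    have h1 := hasSum_trace_basis (EuclideanSpace.basisFun (Fin M) ℂ).toHilbertBasis (D (dyad y x))
    have h2 := h1.unique (hasSum_fintype _)
    rw [hD.tracePreserving, trace_dyad] at h2
    simpa using h2.symm
  · obtain ⟨a, b, h⟩ := exists_isDyadicSum τ.2
    rw [hΛ]
    have h1 := h.hasSum_trace_comp (Λ i j)
    have hs : Summable fun p : basisIndex H × basisIndex (DirectPow M H) =>
        ⟪b p.1, g p.2 j⟫_ℂ * ⟪g p.2 i, a p.1⟫_ℂ := by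
      have h2 := summable_prod_norm_sq_gram (hg j j) h.right
      have h3 := (summable_prod_norm_sq_gram (hg i i) h.left).congr
        (g := fun p => ‖⟪g p.2 i, a p.1⟫_ℂ‖ ^ 2) fun p => by rw [norm_inner_symm]
      exact summable_mul_of_norm_sq (f := fun p : basisIndex H × basisIndex
        (DirectPow M H) => ⟪b p.1, g p.2 j⟫_ℂ)
        (g := fun p => ⟪g p.2 i, a p.1⟫_ℂ) h2 h3
    have h4 := (hs.hasSum.prod_fiberwise fun k => hg j i (b k) (a k)).unique h1
    rw [← h4]
    have h5 := (Equiv.prodComm (basisIndex (DirectPow M H)) (basisIndex H)).hasSum_iff.2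
      hs.hasSum
    refine h5.prod_fiberwise fun l => ?_
    refine (h.hasSum (g l i) (g l j)).congr_fun fun k => ?_
    exact mul_comm _ _

end Gram

/-! ### Fidelity with pure states and with diagonal entangled states. -/

section Fidelity

variable {H K S S' κ ι : Type*} {M : ℕ}
  [NormedAddCommGroup H] [InnerProductSpace ℂ H] [CompleteSpace H]
  [NormedAddCommGroup S] [InnerProductSpace ℂ S] [CompleteSpace S]
  [NormedAddCommGroup S'] [InnerProductSpace ℂ S'] [CompleteSpace S']

theorem traceNorm_dyad_le (a b : H) :
    traceNorm (dyad a b : H →L[ℂ] H) ≤ ENNReal.ofReal (‖a‖ * ‖b‖) := by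
  obtain ⟨W, hW, h⟩ := exists_traceNorm_eq (dyad a b)
  rw [h, trace_comp_dyad]
  refine ENNReal.ofReal_le_ofReal ((Complex.re_le_norm _).trans ((norm_inner_le_norm _ _).trans ?_))
  have : ‖W a‖ ≤ ‖a‖ := (W.le_opNorm a).trans (mul_le_of_le_one_left (norm_nonneg _) hW)
  nlinarith [norm_nonneg b]

/-- A rank-one projection is its own square root, so `√φ √σ = |ψ⟩⟨√σ ψ|` has trace norm at most `‖√σ
ψ‖`, whose square is `⟨ψ, σψ⟩`. -/
theorem fidelity_dyad_le {ψ : H} (hψ : ‖ψ‖ = 1) {σ : TraceClass H}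
    (hσ : (σ : H →L[ℂ] H).IsPositive) :
    fidelity (dyad ψ ψ) σ ≤ ENNReal.ofReal (⟪ψ, (σ : H →L[ℂ] H) ψ⟫_ℂ).re := by
  have h0 := (ContinuousLinearMap.nonneg_iff_isPositive (σ : H →L[ℂ] H)).2 hσ
  set R := CFC.sqrt (σ : H →L[ℂ] H) with hR
  have hRsa : ContinuousLinearMap.adjoint R = R :=
    (IsSelfAdjoint.of_nonneg (CFC.sqrt_nonneg (σ : H →L[ℂ] H))).adjoint_eq
  have hRR : ∀ x, R (R x) = (σ : H →L[ℂ] H) x := fun x =>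
    congrArg (fun T : H →L[ℂ] H => T x) (CFC.sqrt_mul_sqrt_self (σ : H →L[ℂ] H) h0)
  have h1 : CFC.sqrt (dyad ψ ψ : H →L[ℂ] H) = (dyad ψ ψ : H →L[ℂ] H) :=
    CFC.sqrt_unique (InnerProductSpace.isIdempotentElem_rankOne_self hψ)
      ((ContinuousLinearMap.nonneg_iff_isPositive _).2 (isPositive_dyad_self ψ))
  have h2 : (dyad ψ ψ : H →L[ℂ] H) ∘L R = (dyad ψ (R ψ) : H →L[ℂ] H) := by
    rw [coe_dyad, InnerProductSpace.rankOne_comp, hRsa]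
    rfl
  rw [fidelity, h1, ← hR, h2]
  refine (pow_le_pow_left₀ zero_le (traceNorm_dyad_le ψ (R ψ)) 2).trans_eq ?_
  rw [hψ, one_mul, ← ENNReal.ofReal_pow (norm_nonneg _), inner_eq_inner_sqrt hRsa hRR,
    ← ofReal_norm_sq_eq_inner, Complex.ofReal_re]

theorem inner_idTensor (C : TraceClass S →ₗ[ℂ] TraceClass S')
    (ψ : HTensor (EuclideanSpace ℂ (Fin M)) S) (x y : HTensor (EuclideanSpace ℂ (Fin M)) S') :
    ⟪x, (idTensor M C (dyad ψ ψ) : _ →L[ℂ] _) y⟫_ℂ = ∑ i, ∑ j,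
      ⟪ContinuousLinearMap.adjoint (ketLeft (EuclideanSpace.single i (1 : ℂ))) x,
        (C (dyad (ContinuousLinearMap.adjoint (ketLeft (EuclideanSpace.single i (1 : ℂ))) ψ)
          (ContinuousLinearMap.adjoint (ketLeft (EuclideanSpace.single j (1 : ℂ))) ψ)) :
            S' →L[ℂ] S')
        (ContinuousLinearMap.adjoint (ketLeft (EuclideanSpace.single j (1 : ℂ))) y)⟫_ℂ := by
  have hs : ∀ i j : Fin M,
      sandwich (ContinuousLinearMap.adjoint (ketLeft (EuclideanSpace.single i (1 : ℂ))))
        (ketLeft (EuclideanSpace.single j (1 : ℂ))) (dyad ψ ψ) =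
      dyad (ContinuousLinearMap.adjoint (ketLeft (K := S) (EuclideanSpace.single i (1 : ℂ))) ψ)
          (ContinuousLinearMap.adjoint (ketLeft (EuclideanSpace.single j (1 : ℂ))) ψ) :=
    fun i j => Subtype.ext <| ext_inner_operator fun u v => by
      simp [sandwich, ContinuousLinearMap.adjoint_inner_left]
  simp only [idTensor, LinearMap.sum_apply, Submodule.coe_sum, sum_apply,
    inner_sum, LinearMap.comp_apply, hs]
  refine Finset.sum_congr rfl fun i _ => Finset.sum_congr rfl fun j _ => ?_
  rw [ContinuousLinearMap.adjoint_inner_left]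
  rfl

theorem fidelity_idTensor_le {C : TraceClass S →ₗ[ℂ] TraceClass S} (hC : IsCompletelyPositive C)
    {ψ : HTensor (EuclideanSpace ℂ (Fin M)) S} (hψ : ‖ψ‖ = 1) :
    fidelity (dyad ψ ψ) (idTensor M C (dyad ψ ψ)) ≤ ENNReal.ofReal (∑ i, ∑ j,
      ⟪ContinuousLinearMap.adjoint (ketLeft (EuclideanSpace.single i (1 : ℂ))) ψ,
        (C (dyad (ContinuousLinearMap.adjoint (ketLeft (EuclideanSpace.single i (1 : ℂ))) ψ)
          (ContinuousLinearMap.adjoint (ketLeft (EuclideanSpace.single j (1 : ℂ))) ψ)) :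
            S →L[ℂ] S)
        (ContinuousLinearMap.adjoint (ketLeft (EuclideanSpace.single j (1 : ℂ))) ψ)⟫_ℂ).re := by
  rw [← inner_idTensor]
  refine fidelity_dyad_le hψ (isPositive_of_inner_nonneg fun z => ?_)
  rw [inner_idTensor]
  exact hC M _ (sum_inner_dyad_nonneg _) _

theorem isCompletelyPositive_comp {C : TraceClass S →ₗ[ℂ] TraceClass S'}
    {D : TraceClass S' →ₗ[ℂ] TraceClass H} (hD : IsCompletelyPositive D)
    (hC : IsCompletelyPositive C) : IsCompletelyPositive (D ∘ₗ C) :=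
  fun k τ h => hD k (fun i j => C (τ i j)) (hC k τ h)

theorem IsChannel.comp {C : TraceClass S →ₗ[ℂ] TraceClass S'}
    {D : TraceClass S' →ₗ[ℂ] TraceClass H} (hD : IsChannel D)
    (hC : IsChannel C) : IsChannel (D ∘ₗ C) :=
  ⟨isCompletelyPositive_comp hD.completelyPositive hC.completelyPositive, fun _ =>
    (hD.tracePreserving _).trans (hC.tracePreserving _)⟩

/-- The vector `∑ᵢ cᵢ |i⟩ ⊗ |i⟩`. -/
def diagVector (c : Fin M → ℝ) :
    HTensor (EuclideanSpace ℂ (Fin M)) (EuclideanSpace ℂ (Fin M)) :=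
  ∑ i, (c i : ℂ) • ketLeft (EuclideanSpace.single i (1 : ℂ)) (EuclideanSpace.single i (1 : ℂ))

theorem adjoint_ketLeft_diagVector (c : Fin M → ℝ) (i : Fin M) :
    ContinuousLinearMap.adjoint (ketLeft (EuclideanSpace.single i (1 : ℂ))) (diagVector c) =
      (c i : ℂ) • EuclideanSpace.single i (1 : ℂ) := by
  refine ext_inner_left ℂ fun x => ?_
  rw [ContinuousLinearMap.adjoint_inner_right, diagVector, inner_sum,
    Finset.sum_eq_single_of_mem i (Finset.mem_univ i)]
  · rw [inner_smul_right, inner_ketLeft, inner_smul_right]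
    simp
  · intro j _ hj
    rw [inner_smul_right, inner_ketLeft, EuclideanSpace.inner_single_left]
    simp [hj.symm]

theorem norm_sq_diagVector (c : Fin M → ℝ) : ‖diagVector c‖ ^ 2 = ∑ i, c i ^ 2 := by
  have h : ((‖diagVector c‖ ^ 2 : ℝ) : ℂ) = ((∑ i, c i ^ 2 : ℝ) : ℂ) := by
    rw [ofReal_norm_sq_eq_inner]
    nth_rw 1 [diagVector]
    rw [sum_inner]
    push_cast
    refine Finset.sum_congr rfl fun i _ => ?_
    rw [inner_smul_left, ← ContinuousLinearMap.adjoint_inner_right, adjoint_ketLeft_diagVector]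
    simp [sq]
  exact_mod_cast h

/-- The input contributes `cᵢcⱼ` and the overlap with the same vector contributes it again. A point
mass `c` tests the transmission of one message; constant `c` gives the entanglement fidelity. -/
theorem fidelity_diagVector_le
    {C : TraceClass (EuclideanSpace ℂ (Fin M)) →ₗ[ℂ] TraceClass (EuclideanSpace ℂ (Fin M))}
    (hC : IsCompletelyPositive C) {c : Fin M → ℝ} (hc : ∑ i, c i ^ 2 = 1) :
    fidelity (dyad (diagVector c) (diagVector c))
      (idTensor M C (dyad (diagVector c) (diagVector c))) ≤ ENNReal.ofReal (∑ i, ∑ j,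
      ((c i ^ 2 * c j ^ 2 : ℝ) : ℂ) * ⟪EuclideanSpace.single i (1 : ℂ),
        (C (dyad (EuclideanSpace.single i (1 : ℂ)) (EuclideanSpace.single j (1 : ℂ))) : _ →L[ℂ] _)
        (EuclideanSpace.single j (1 : ℂ))⟫_ℂ).re := by
  have h1 : ‖diagVector c‖ = 1 := by
    have := norm_sq_diagVector c
    rw [hc] at this
    exact (pow_eq_one_iff_of_nonneg (norm_nonneg _) two_ne_zero).1 this
  refine (fidelity_idTensor_le hC h1).trans_eq ?_
  congr 2
  refine Finset.sum_congr rfl fun i _ => Finset.sum_congr rfl fun j _ => ?_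
  simp only [adjoint_ketLeft_diagVector, dyad_smul_left, dyad_smul_right, map_smul,
    inner_smul_left, inner_smul_right, Complex.conj_ofReal, Submodule.coe_smul,
    smul_apply]
  push_cast
  ring

end Fidelity

/-! ### Trace distance from overlaps, and the common environment state. -/

section TraceDistance

variable {H κ α : Type*} {M : ℕ}
  [NormedAddCommGroup H] [InnerProductSpace ℂ H] [CompleteSpace H]

theorem tsum_mul_le_sqrt_mul_sqrt {f g : κ → ℝ} {s t : ℝ} (hf : HasSum (fun k => f k ^ 2) s)
    (hg : HasSum (fun k => g k ^ 2) t) : ∑' k, f k * g k ≤ √s * √t := by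
  refine (summable_mul_of_sq hf.summable hg.summable).tsum_le_of_sum_le fun F => ?_
  refine (Real.sum_mul_le_sqrt_mul_sqrt F f g).trans ?_
  gcongr
  · exact sum_le_hasSum F (fun _ _ => by positivity) hf
  · exact sum_le_hasSum F (fun _ _ => by positivity) hg

theorem IsDyadicSum.hasSum_norm_sq {X : H →L[ℂ] H} {a : κ → H} (h : IsDyadicSum X a a) :
    HasSum (fun k => ‖a k‖ ^ 2) (trace X).re := by
  have := Complex.hasSum_re h.hasSum_trace
  simpa only [← ofReal_norm_sq_eq_inner, Complex.ofReal_re] using this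

/-- A difference of quadratic forms is the symmetrized form in `x - y` and `x + y`. Followed by
Cauchy–Schwarz over the index, this yields the sharp bound `2√(1 - c²)` without purifying spaces. -/
theorem norm_inner_apply_sub_le {W : H →L[ℂ] H} (hW : ‖W‖ ≤ 1) (x y : H) :
    ‖⟪x, W x⟫_ℂ - ⟪y, W y⟫_ℂ‖ ≤ ‖x - y‖ * ‖x + y‖ := by
  have hWz : ∀ z, ‖W z‖ ≤ ‖z‖ := fun z =>
    (W.le_opNorm z).trans (mul_le_of_le_one_left (norm_nonneg _) hW)
  have h : ⟪x, W x⟫_ℂ - ⟪y, W y⟫_ℂ =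
      2⁻¹ * (⟪x - y, W (x + y)⟫_ℂ + ⟪x + y, W (x - y)⟫_ℂ) := by
    simp only [map_add, map_sub, inner_add_left, inner_add_right, inner_sub_left, inner_sub_right]
    ring
  have h1 := (norm_inner_le_norm (𝕜 := ℂ) (x - y) (W (x + y))).trans
    (mul_le_mul_of_nonneg_left (hWz (x + y)) (norm_nonneg _))
  have h2 := (norm_inner_le_norm (𝕜 := ℂ) (x + y) (W (x - y))).trans
    (mul_le_mul_of_nonneg_left (hWz (x - y)) (norm_nonneg _))
  have h3 := norm_add_le ⟪x - y, W (x + y)⟫_ℂ ⟪x + y, W (x - y)⟫_ℂ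
  have h4 : ‖(2⁻¹ : ℂ)‖ = 2⁻¹ := by norm_num
  rw [h, norm_mul, h4]
  linarith

theorem hasSum_norm_sub_sq {a b : κ → H} {c : ℝ} (ha : HasSum (fun k => ‖a k‖ ^ 2) 1)
    (hb : HasSum (fun k => ‖b k‖ ^ 2) 1) (hc : HasSum (fun k => (⟪a k, b k⟫_ℂ).re) c) :
    HasSum (fun k => ‖a k - b k‖ ^ 2) (2 - 2 * c) := by
  have h1 := (ha.sub (hc.mul_left 2)).add hb
  have h2 : 2 - 2 * c = 1 - 2 * c + 1 := by ring
  rw [h2]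
  refine h1.congr_fun fun k => ?_
  exact norm_sub_sq (𝕜 := ℂ) (a k) (b k)

theorem hasSum_norm_add_sq {a b : κ → H} {c : ℝ} (ha : HasSum (fun k => ‖a k‖ ^ 2) 1)
    (hb : HasSum (fun k => ‖b k‖ ^ 2) 1) (hc : HasSum (fun k => (⟪a k, b k⟫_ℂ).re) c) :
    HasSum (fun k => ‖a k + b k‖ ^ 2) (2 + 2 * c) := by
  have h1 := (ha.add (hc.mul_left 2)).add hb
  have h2 : 2 + 2 * c = 1 + 2 * c + 1 := by ring
  rw [h2]
  refine h1.congr_fun fun k => ?_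
  exact norm_add_sq (𝕜 := ℂ) (a k) (b k)

/-- The trace distance of two states is bounded by the overlap of purifications. -/
theorem traceNorm_sub_le {θ ω : TraceClass H} {a b : κ → H} {c : ℝ}
    (hθ : IsDyadicSum (θ : H →L[ℂ] H) a a) (hω : IsDyadicSum (ω : H →L[ℂ] H) b b)
    (hθ1 : trace (θ : H →L[ℂ] H) = 1) (hω1 : trace (ω : H →L[ℂ] H) = 1)
    (hc : HasSum (fun k => (⟪a k, b k⟫_ℂ).re) c) :
    traceNorm (θ - ω : H →L[ℂ] H) ≤ ENNReal.ofReal (√(2 - 2 * c) * √(2 + 2 * c)) := by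
  have ha : HasSum (fun k => ‖a k‖ ^ 2) 1 := by simpa [hθ1] using hθ.hasSum_norm_sq
  have hb : HasSum (fun k => ‖b k‖ ^ 2) 1 := by simpa [hω1] using hω.hasSum_norm_sq
  obtain ⟨W, hW, h⟩ := exists_traceNorm_eq (θ - ω)
  have h1 : trace (W ∘L ((θ - ω : TraceClass H) : H →L[ℂ] H)) =
      trace (W ∘L (θ : H →L[ℂ] H)) - trace (W ∘L (ω : H →L[ℂ] H)) := map_sub (traceComp W) θ ω
  have h2 := Complex.hasSum_re ((hθ.hasSum_trace_comp W).sub (hω.hasSum_trace_comp W))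
  rw [← h1] at h2
  change traceNorm ((θ - ω : TraceClass H) : H →L[ℂ] H) ≤ _
  rw [h]
  refine ENNReal.ofReal_le_ofReal ?_
  have h3 := hasSum_norm_sub_sq ha hb hc
  have h4 := hasSum_norm_add_sq ha hb hc
  refine le_trans ?_ (tsum_mul_le_sqrt_mul_sqrt h3 h4)
  exact hasSum_le (fun k => (Complex.re_le_norm _).trans (norm_inner_apply_sub_le hW _ _)) h2
    (summable_mul_of_sq h3.summable h4.summable).hasSum

theorem sqrt_mul_sqrt_le {c r : ℝ} (hr : 0 ≤ r) (h : 4 * (1 - c ^ 2) ≤ r ^ 2) (hc : c ≤ 1) :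
    √(2 - 2 * c) * √(2 + 2 * c) ≤ r := by
  rw [← Real.sqrt_mul (by linarith)]
  refine Real.sqrt_le_iff.2 ⟨hr, ?_⟩
  nlinarith

theorem half_mul_ofReal_le {x : ℝ≥0∞} {r : ℝ} (h : x ≤ ENNReal.ofReal (2 * r)) :
    2⁻¹ * x ≤ ENNReal.ofReal r := by
  rw [ENNReal.inv_mul_le_iff (by norm_num) (by norm_num)]
  rwa [ENNReal.ofReal_mul (by norm_num), ENNReal.ofReal_ofNat] at h

theorem overlap_le_one {a b : κ → H} {c : ℝ} (ha : HasSum (fun k => ‖a k‖ ^ 2) 1)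
    (hb : HasSum (fun k => ‖b k‖ ^ 2) 1) (hc : HasSum (fun k => (⟪a k, b k⟫_ℂ).re) c) : c ≤ 1 := by
  have := (hasSum_norm_sub_sq ha hb hc).nonneg fun _ => by positivity
  linarith

/-- Any two dyadic decompositions over the same index set will do, as `4(1 - c²) ≤ 4` whatever the
overlap. -/
theorem traceNorm_sub_le_two {θ ω : TraceClass H} (hθ : IsDensity θ) (hω : IsDensity ω) :
    traceNorm (θ - ω : H →L[ℂ] H) ≤ ENNReal.ofReal 2 := by
  obtain ⟨a, ha⟩ := exists_isDyadicSum_self hθ.1 θ.2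
  obtain ⟨b, hb⟩ := exists_isDyadicSum_self hω.1 ω.2
  obtain ⟨z, hz⟩ := summable_inner_of_norm_sq ha.left hb.left
  have hc := Complex.hasSum_re hz
  refine (traceNorm_sub_le ha hb hθ.2 hω.2 hc).trans (ENNReal.ofReal_le_ofReal ?_)
  refine sqrt_mul_sqrt_le (by norm_num) (by nlinarith [sq_nonneg z.re])
    (overlap_le_one ?_ ?_ hc)
  · simpa [hθ.2] using ha.hasSum_norm_sq
  · simpa [hω.2] using hb.hasSum_norm_sq

theorem hasSum_prod_single {R : Type*} [AddCommMonoid R] [TopologicalSpace R] [DecidableEq α]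
    (m : α) {f : κ → R} {s : R}
    (hf : HasSum f s) : HasSum (fun q : κ × α => if q.2 = m then f q.1 else 0) s := by
  have hinj : Function.Injective fun p : κ => (p, m) := fun p p' h => (Prod.ext_iff.1 h).1
  refine (hinj.hasSum_iff ?_).1 (by simpa [Function.comp_def] using hf)
  rintro ⟨p, i⟩ hq
  by_cases h : i = m
  · exact absurd ⟨p, by rw [h]⟩ hq
  · simp [h]

theorem hasSum_prod_fintype [Fintype α] {f : κ → α → ℂ} {s : α → ℂ}
    (hf : ∀ i, HasSum (fun p => f p i) (s i)) :
    HasSum (fun q : κ × α => f q.1 q.2) (∑ i, s i) := by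
  classical
  refine (hasSum_sum (s := Finset.univ) fun i _ => hasSum_prod_single i (hf i)).congr_fun
    fun q => ?_
  simp

theorem isDyadicSum_single [DecidableEq α] (m : α) {X : H →L[ℂ] H} {b : κ → H}
    (h : IsDyadicSum X b b) :
    IsDyadicSum X (fun q : κ × α => if q.2 = m then b q.1 else 0)
      (fun q : κ × α => if q.2 = m then b q.1 else 0) := by
  have hs : Summable fun q : κ × α => ‖if q.2 = m then b q.1 else 0‖ ^ 2 := by
    refine (hasSum_prod_single m h.left.hasSum).summable.congr fun q => ?_
    split_ifs <;> simp
  refine ⟨hs, hs, fun y x => (hasSum_prod_single m (h.hasSum y x)).congr_fun fun q => ?_⟩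
  split_ifs <;> simp

/-- Markov's inequality on a finite set. -/
theorem half_le_card_filter {d : Fin M → ℝ} {δ : ℝ} (hd : ∀ m, 0 ≤ d m)
    (hδ : ∑ m, d m ≤ M * δ) : M / 2 ≤ (Finset.univ.filter fun m => d m ≤ 2 * δ).card := by
  set s := Finset.univ.filter fun m => d m ≤ 2 * δ with hs
  have hcard : s.card + (Finset.univ.filter fun m => ¬ d m ≤ 2 * δ).card = M := by
    rw [hs, Finset.card_filter_add_card_filter_not, Finset.card_univ, Fintype.card_fin]
  set b := Finset.univ.filter fun m => ¬ d m ≤ 2 * δ with hb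
  rcases b.eq_empty_or_nonempty with h0 | hne
  · rw [h0, Finset.card_empty] at hcard
    omega
  have h1 : ∑ _m ∈ b, 2 * δ < ∑ m ∈ b, d m :=
    Finset.sum_lt_sum_of_nonempty hne fun m hm => not_le.1 (Finset.mem_filter.1 hm).2
  have h2 : ∑ m ∈ b, d m ≤ ∑ m, d m :=
    Finset.sum_le_sum_of_subset_of_nonneg (Finset.subset_univ _) fun m _ _ => hd m
  rw [Finset.sum_const, nsmul_eq_mul] at h1
  have h3 : (b.card : ℝ) * 2 * δ < M * δ := by linarith
  have h4 : 0 ≤ δ := by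
    by_contra h
    have hM : (0 : ℝ) ≤ ∑ m, d m := Finset.sum_nonneg fun m _ => hd m
    have : (M : ℝ) * δ ≤ 0 := mul_nonpos_of_nonneg_of_nonpos M.cast_nonneg (le_of_not_ge h)
    obtain ⟨m, hm⟩ := hne
    have hMpos : (0 : ℝ) < M := by exact_mod_cast (Fin.pos m)
    nlinarith
  -- Strictness makes the bad indices fewer than half, so the good ones number at least the
  -- rounded-down half.
  have h5 : (b.card : ℝ) * 2 < M := lt_of_mul_lt_mul_right h3 h4
  have h6 : b.card * 2 < M := by exact_mod_cast h5
  omega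

/-- If the vectors `w p i i` are on average close to their mean, then most of the states
`∑ |w p i m⟩⟨w p i m|` are close to a common state. -/
theorem exists_common_state (hM : 0 < M) {w : κ → Fin M → Fin M → H} {θ : Fin M → TraceClass H}
    (hθ : ∀ m, IsDyadicSum (θ m : H →L[ℂ] H) (fun q : κ × Fin M => w q.1 q.2 m)
      (fun q : κ × Fin M => w q.1 q.2 m))
    (htr : ∀ m, trace (θ m : H →L[ℂ] H) = 1) {t : Fin M → Fin M → ℂ}
    (ht : ∀ i j, HasSum (fun p => ⟪w p j j, w p i i⟫_ℂ) (t i j)) {ε : ℝ} (hε₀ : 0 ≤ ε)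
    (hF : (M : ℝ) ^ 2 * (1 - ε) ≤ (∑ i, ∑ j, t i j).re) :
    ∃ ω : TraceClass H, IsDensity ω ∧ ∃ s : Finset (Fin M), M / 2 ≤ s.card ∧
      ∀ m ∈ s, 2⁻¹ * traceNorm (θ m - ω : H →L[ℂ] H) ≤ ENNReal.ofReal (2 * √ε) := by
  have hden : ∀ m, IsDensity (θ m) := fun m => ⟨(hθ m).isPositive, htr m⟩
  have hM' : (0 : ℝ) < M := by exact_mod_cast hM
  -- For `ε ≥ 1/4` the bound `2√ε` is at least one and any state serves. Otherwise `F > 3/4`, which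
  -- makes `2√F - 1` positive, as needed for squaring at the end.
  rcases le_or_gt (1 / 4) ε with hε | hε
  · refine ⟨θ ⟨0, hM⟩, hden _, Finset.univ, by simp; omega, fun m _ => half_mul_ofReal_le ?_⟩
    refine (traceNorm_sub_le_two (hden m) (hden _)).trans (ENNReal.ofReal_le_ofReal ?_)
    have : 1 / 2 ≤ √ε := Real.le_sqrt_of_sq_le (by linarith)
    linarith
  set F : ℝ := (∑ i, ∑ j, t i j).re / M ^ 2 with hFdef
  have hF1 : 1 - ε ≤ F := by rw [hFdef, le_div_iff₀ (by positivity)]; linarith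
  have hFpos : 0 < F := by linarith
  set s := √F with hs
  have hspos : 0 < s := Real.sqrt_pos.2 hFpos
  have hs2 : s ^ 2 = F := Real.sq_sqrt hFpos.le
  -- The squared norms of `∑ᵢ w p i i` add up to `M²F`, so dividing by `M√F` normalizes the family.
  let v : κ → H := fun p => ((M : ℝ) * s : ℂ)⁻¹ • ∑ i, w p i i
  have hwv : HasSum (fun p => ⟪∑ i, w p i i, ∑ i, w p i i⟫_ℂ) (∑ i, ∑ j, t i j) := by
    refine (hasSum_sum (s := Finset.univ) fun i _ => hasSum_sum (s := Finset.univ) fun j _ =>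
      ht i j).congr_fun fun p => ?_
    rw [inner_sum]
    refine Finset.sum_congr rfl fun i _ => ?_
    rw [sum_inner]
  have hwv' : HasSum (fun p => ‖∑ i, w p i i‖ ^ 2) ((M : ℝ) ^ 2 * F) := by
    have h1 := Complex.hasSum_re hwv
    simp only [← ofReal_norm_sq_eq_inner, Complex.ofReal_re] at h1
    rwa [hFdef, mul_div_cancel₀ _ (by positivity)]
  have hc0 : ((M : ℝ) * s : ℂ)⁻¹ = ((((M : ℝ) * s)⁻¹ : ℝ) : ℂ) := by push_cast; rfl
  have hv1 : HasSum (fun p => ‖v p‖ ^ 2) 1 := by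
    have h1 := hwv'.mul_left ((((M : ℝ) * s)⁻¹) ^ 2)
    have h2 : (((M : ℝ) * s)⁻¹) ^ 2 * ((M : ℝ) ^ 2 * F) = 1 := by
      rw [← hs2]; field_simp
    rw [h2] at h1
    refine h1.congr_fun fun p => ?_
    simp only [v]
    rw [norm_smul, mul_pow, hc0, Complex.norm_real, Real.norm_eq_abs, sq_abs]
  let ω : TraceClass H := dyadSum v v hv1.summable hv1.summable
  have hω : IsDyadicSum (ω : H →L[ℂ] H) v v := isDyadicSum_dyadSum _ _
  have hω1 : trace (ω : H →L[ℂ] H) = 1 := by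
    refine hω.hasSum_trace.unique ?_
    have := Complex.hasSum_ofReal.2 hv1
    simpa only [ofReal_norm_sq_eq_inner, Complex.ofReal_one] using this
  -- The family `v` is placed in slot `m` of the extra index, so its overlap with the decomposition
  -- of `θ m` sees only the vectors `w p m m`, those of the correct outcome.
  let b : Fin M → κ × Fin M → H := fun m q => if q.2 = m then v q.1 else 0
  have hb : ∀ m, IsDyadicSum (ω : H →L[ℂ] H) (b m) (b m) := fun m => isDyadicSum_single m hω
  have hc : ∀ m, HasSum (fun q : κ × Fin M => (⟪w q.1 q.2 m, b m q⟫_ℂ).re)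
      (∑' q : κ × Fin M, (⟪w q.1 q.2 m, b m q⟫_ℂ).re) := fun m =>
    (Complex.hasSum_re (summable_inner_of_norm_sq (hθ m).left (hb m).left).hasSum).summable.hasSum
  set c : Fin M → ℝ := fun m => ∑' q : κ × Fin M, (⟪w q.1 q.2 m, b m q⟫_ℂ).re with hcdef
  have hc1 : ∀ m, c m ≤ 1 := fun m => overlap_le_one
    (by simpa [htr] using (hθ m).hasSum_norm_sq) (by simpa [hω1] using (hb m).hasSum_norm_sq) (hc m)
  have hcv : ∀ m, HasSum (fun p => (⟪w p m m, v p⟫_ℂ).re) (c m) := fun m => by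
    have hinj : Function.Injective fun p : κ => (p, m) := fun p p' h => (Prod.ext_iff.1 h).1
    refine ((hinj.hasSum_iff ?_).2 (hc m)).congr_fun fun p => ?_
    · rintro ⟨p, i⟩ hq
      have : i ≠ m := fun h => hq ⟨p, by rw [h]⟩
      simp [b, this]
    · simp [b]
  -- Since `v` is proportional to `∑ₘ w p m m`, the overlaps add up to `(M√F)⁻¹ · M²F`.
  have hsum : ∑ m, c m = M * s := by
    refine (hasSum_sum (s := Finset.univ) fun m _ => hcv m).unique ?_
    have h1 := hwv'.mul_left (((M : ℝ) * s)⁻¹)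
    have h2 : ((M : ℝ) * s)⁻¹ * ((M : ℝ) ^ 2 * F) = M * s := by
      rw [← hs2]; field_simp
    rw [h2] at h1
    refine h1.congr_fun fun p => ?_
    rw [← Complex.re_sum, ← sum_inner]
    simp only [v]
    rw [inner_smul_right, hc0, ← ofReal_norm_sq_eq_inner, ← Complex.ofReal_mul, Complex.ofReal_re]
  refine ⟨ω, ⟨hω.isPositive, hω1⟩, Finset.univ.filter fun m => 1 - c m ≤ 2 * (1 - s),
    half_le_card_filter (fun m => by linarith [hc1 m]) ?_, fun m hm => half_mul_ofReal_le ?_⟩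
  · rw [Finset.sum_sub_distrib, hsum]
    simp
    linarith
  · have hm' := (Finset.mem_filter.1 hm).2
    refine (traceNorm_sub_le (hθ m) (hb m) (htr m) hω1 (hc m)).trans (ENNReal.ofReal_le_ofReal ?_)
    refine sqrt_mul_sqrt_le (by positivity) ?_ (hc1 m)
    have hsε := Real.sq_sqrt hε₀
    have hs1 : s ≤ 1 := by
      have : ∑ m, c m ≤ ∑ _m : Fin M, (1 : ℝ) := Finset.sum_le_sum fun m _ => hc1 m
      rw [hsum] at this
      simp at this
      nlinarith
    have hs34 : 1 / 2 ≤ s := by nlinarith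
    have hcm : 2 * s - 1 ≤ c m := by linarith
    have h1 : (2 * s - 1) ^ 2 ≤ c m ^ 2 := pow_le_pow_left₀ (by linarith) hcm 2
    -- Indeed `s(1 - s) ≤ 1 - s² = 1 - F ≤ ε`. Hence `4(1 - c²) ≤ 4(1 - (2s - 1)²) = 16 s(1 - s) ≤
    -- (4√ε)²`.
    have h2 : s * (1 - s) ≤ ε := by nlinarith
    nlinarith

end TraceDistance

/-! ### Environment vectors and the conversion of the code. -/

section Conversion

variable {A B E κ ν ι : Type*} {M : ℕ}
  [NormedAddCommGroup A] [InnerProductSpace ℂ A] [CompleteSpace A]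
  [NormedAddCommGroup B] [InnerProductSpace ℂ B] [CompleteSpace B]
  [NormedAddCommGroup E] [InnerProductSpace ℂ E] [CompleteSpace E]

theorem summable_prod_slice {f : κ × ν → ℝ} (hf : Summable f) (i : ν) :
    Summable fun p => f (p, i) :=
  hf.comp_injective (i := fun p => (p, i)) fun _ _ h => (Prod.ext_iff.1 h).1

/-- The environment vector `(⟨g| ⊗ I) U a`. -/
def envVector (U : A →ₗᵢ[ℂ] HTensor B E) (g : B) (a : A) : E :=
  ContinuousLinearMap.adjoint (ketLeft g) (U a)

/-- The operator `(I ⊗ ⟨y|) U`. -/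
def envSlice (U : A →ₗᵢ[ℂ] HTensor B E) (y : E) : A →L[ℂ] B :=
  ContinuousLinearMap.adjoint (ketRight y) ∘L U.toContinuousLinearMap

theorem inner_envVector_right (U : A →ₗᵢ[ℂ] HTensor B E) (g : B) (a : A) (y : E) :
    ⟪y, envVector U g a⟫_ℂ = ⟪g, envSlice U y a⟫_ℂ := by
  rw [envVector, envSlice, ContinuousLinearMap.adjoint_inner_right,
    ContinuousLinearMap.comp_apply, ContinuousLinearMap.adjoint_inner_right]
  rfl

theorem inner_envVector_left (U : A →ₗᵢ[ℂ] HTensor B E) (g : B) (a : A) (y : E) :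
    ⟪envVector U g a, y⟫_ℂ = ⟪envSlice U y a, g⟫_ℂ := by
  rw [← inner_conj_symm, inner_envVector_right, inner_conj_symm]

/-- The output of the complementary channel, expanded along a frame `∑ᵢₗ |gₗᵢ⟩⟨gₗᵢ| = I`. -/
theorem isDyadicSum_channelLeft (U : A →ₗᵢ[ℂ] HTensor B E) (e : HilbertBasis ι ℂ B)
    {g : ν → Fin M → B} {Λ : Fin M → B →L[ℂ] B} (hΛ : IsPOVM Λ)
    (hg : ∀ m y x, HasSum (fun l => ⟪y, g l m⟫_ℂ * ⟪g l m, x⟫_ℂ) ⟪y, Λ m x⟫_ℂ)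
    {ρ : TraceClass A} {a : κ → A} (ha : IsDyadicSum (ρ : A →L[ℂ] A) a a) :
    IsDyadicSum (channelLeft U e ρ : E →L[ℂ] E)
      (fun q : (κ × ν) × Fin M => envVector U (g q.1.2 q.2) (a q.1.1))
      (fun q : (κ × ν) × Fin M => envVector U (g q.1.2 q.2) (a q.1.1)) := by
  -- For a fixed outcome `i`, summing over `l` inserts `Λᵢ` between the slices of `U`; summing over
  -- the outcomes below then removes it, because `∑ᵢ Λᵢ = I`. The frame thus replaces an orthonormal
  -- basis in the partial trace.
  have hsum : ∀ i y x, HasSum (fun p : κ × ν =>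
      ⟪y, envVector U (g p.2 i) (a p.1)⟫_ℂ * ⟪envVector U (g p.2 i) (a p.1), x⟫_ℂ)
      (trace ((ContinuousLinearMap.adjoint (envSlice U x) ∘L Λ i ∘L envSlice U y) ∘L
        (ρ : A →L[ℂ] A))) := by
    intro i y x
    have h1 : ∀ z, Summable fun p : κ × ν => ‖⟪envSlice U z (a p.1), g p.2 i⟫_ℂ‖ ^ 2 := fun z =>
      summable_prod_norm_sq_gram (a := fun k => envSlice U z (a k)) (g := fun l => g l i) (hg i)
        (summable_norm_sq_apply ha.left (envSlice U z))
    have h2 : Summable fun p : κ × ν => ‖⟪g p.2 i, envSlice U y (a p.1)⟫_ℂ‖ ^ 2 :=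
      (h1 y).congr fun p => by rw [norm_inner_symm]
    have h3 : Summable fun p : κ × ν =>
        ⟪envSlice U x (a p.1), g p.2 i⟫_ℂ * ⟪g p.2 i, envSlice U y (a p.1)⟫_ℂ :=
      summable_mul_of_norm_sq (f := fun p : κ × ν => ⟪envSlice U x (a p.1), g p.2 i⟫_ℂ)
        (g := fun p : κ × ν => ⟪g p.2 i, envSlice U y (a p.1)⟫_ℂ) (h1 x) h2
    have h4 := h3.hasSum.prod_fiberwise fun k =>
      hg i (envSlice U x (a k)) (envSlice U y (a k))
    have h5 := ha.hasSum_trace_comp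
      (ContinuousLinearMap.adjoint (envSlice U x) ∘L Λ i ∘L envSlice U y)
    have h6 := h4.unique (h5.congr_fun fun k => by
      rw [ContinuousLinearMap.comp_apply, ContinuousLinearMap.adjoint_inner_right]
      rfl)
    rw [← h6]
    refine h3.hasSum.congr_fun fun p => ?_
    rw [inner_envVector_right, inner_envVector_left, mul_comm]
  have htot : ∀ y x, HasSum (fun q : (κ × ν) × Fin M =>
      ⟪y, envVector U (g q.1.2 q.2) (a q.1.1)⟫_ℂ * ⟪envVector U (g q.1.2 q.2) (a q.1.1), x⟫_ℂ)
      ⟪y, (channelLeft U e ρ : E →L[ℂ] E) x⟫_ℂ := by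
    intro y x
    have h1 := hasSum_prod_fintype (f := fun (p : κ × ν) i =>
      ⟪y, envVector U (g p.2 i) (a p.1)⟫_ℂ * ⟪envVector U (g p.2 i) (a p.1), x⟫_ℂ)
      fun i => hsum i y x
    have h2 := hasSum_sum (s := Finset.univ) fun i _ => ha.hasSum_trace_comp
      (ContinuousLinearMap.adjoint (envSlice U x) ∘L Λ i ∘L envSlice U y)
    have h3 := (isChannel_channelLeft U e).hasSum_inner ha y x
    rw [h2.unique (h3.congr_fun fun k => ?_)] at h1
    · exact h1
    · simp only [ContinuousLinearMap.comp_apply, ContinuousLinearMap.adjoint_inner_right]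
      rw [← inner_sum, ← sum_apply, hΛ.2]
      exact (inner_channelLeft_dyad U e (a k) (a k) y x).symm
  -- Square summability over all indices comes from the output being trace class.
  have hs := summable_norm_sq_of_traceClass fun y => htot y y
  exact ⟨hs, hs, htot⟩

/-- The matrix elements of `D ∘ N ∘ C` in terms of environment vectors. -/
theorem hasSum_inner_envVector (U : A →ₗᵢ[ℂ] HTensor B E) (e : HilbertBasis ι ℂ E)
    {D : TraceClass B →ₗ[ℂ] TraceClass (EuclideanSpace ℂ (Fin M))} (hD : IsChannel D)
    {g : ν → Fin M → B}
    (hg : ∀ i j (τ : TraceClass B), HasSum (fun l => ⟪g l i, (τ : B →L[ℂ] B) (g l j)⟫_ℂ)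
      ⟪EuclideanSpace.single i (1 : ℂ), (D τ : _ →L[ℂ] _) (EuclideanSpace.single j (1 : ℂ))⟫_ℂ)
    {ρ : TraceClass A} {a b : κ → A} (ha : IsDyadicSum (ρ : A →L[ℂ] A) a b) (i j : Fin M)
    (hi : Summable fun p : κ × ν => ‖envVector U (g p.2 i) (a p.1)‖ ^ 2)
    (hj : Summable fun p : κ × ν => ‖envVector U (g p.2 j) (b p.1)‖ ^ 2) :
    HasSum (fun p : κ × ν =>
      ⟪envVector U (g p.2 j) (b p.1), envVector U (g p.2 i) (a p.1)⟫_ℂ)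
      ⟪EuclideanSpace.single i (1 : ℂ),
        (D (channelRight U e ρ) : _ →L[ℂ] _) (EuclideanSpace.single j (1 : ℂ))⟫_ℂ := by
  -- Normality of `D ∘ N` reduces the claim to dyads, where the sum over `l` is the decoder's
  -- expansion.
  have h1 := (hD.comp (isChannel_channelRight U e)).hasSum_inner ha
    (EuclideanSpace.single i (1 : ℂ)) (EuclideanSpace.single j (1 : ℂ))
  have h2 := (summable_inner_of_norm_sq hj hi).hasSum
  have h3 := h2.prod_fiberwise fun k => by
    have := hg i j (channelRight U e (dyad (a k) (b k)))
    simp only [inner_channelRight_dyad] at this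
    exact this
  rw [h3.unique h1] at h2
  exact h2

/-- Used to see that merging discarded outcomes into a kept one cannot lower its success
probability. -/
theorem trace_comp_mono {ρ : TraceClass A} (hρ : (ρ : A →L[ℂ] A).IsPositive) {Y Z : A →L[ℂ] A}
    (hYZ : (Z - Y).IsPositive) :
    (trace (Y ∘L (ρ : A →L[ℂ] A))).re ≤ (trace (Z ∘L (ρ : A →L[ℂ] A))).re := by
  obtain ⟨a, ha⟩ := exists_isDyadicSum_self hρ ρ.2
  refine hasSum_le (fun k => ?_) (Complex.hasSum_re (ha.hasSum_trace_comp Y))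
    (Complex.hasSum_re (ha.hasSum_trace_comp Z))
  have := (Complex.nonneg_iff.1 (hYZ.inner_nonneg_right (a k))).1
  rw [sub_apply, inner_sub_right, Complex.sub_re] at this
  linarith

/-- Keep only the outcomes in the range of `σ`; the others are counted as outcome zero. -/
def restrictPOVM {L : ℕ} (σ : Fin L ↪ Fin M) (Λ : Fin M → B →L[ℂ] B) (m : Fin L) : B →L[ℂ] B :=
  Λ (σ m) + if (m : ℕ) = 0 then ∑ j ∈ Finset.univ \ Finset.univ.map σ, Λ j else 0

theorem isPositive_restrictPOVM_sub {L : ℕ} (σ : Fin L ↪ Fin M) {Λ : Fin M → B →L[ℂ] B}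
    (hΛ : IsPOVM Λ) (m : Fin L) : (restrictPOVM σ Λ m - Λ (σ m)).IsPositive := by
  rw [restrictPOVM, add_sub_cancel_left]
  split_ifs
  · exact ContinuousLinearMap.isPositive_sum _ fun j _ => hΛ.1 j
  · exact ContinuousLinearMap.isPositive_zero

theorem isPOVM_restrictPOVM {L : ℕ} (hL : 0 < L) (σ : Fin L ↪ Fin M) {Λ : Fin M → B →L[ℂ] B}
    (hΛ : IsPOVM Λ) : IsPOVM (restrictPOVM σ Λ) := by
  refine ⟨fun m => ?_, ?_⟩
  · have := (isPositive_restrictPOVM_sub σ hΛ m).add (hΛ.1 (σ m))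
    rwa [sub_add_cancel] at this
  · simp only [restrictPOVM]
    rw [Finset.sum_add_distrib, Finset.sum_eq_single_of_mem (⟨0, hL⟩ : Fin L) (Finset.mem_univ _)
      (f := fun m : Fin L => if (m : ℕ) = 0 then
        ∑ j ∈ Finset.univ \ Finset.univ.map σ, Λ j else 0) fun m _ hm =>
        if_neg fun h => hm (Fin.ext h)]
    rw [if_pos rfl, ← Finset.sum_map Finset.univ σ Λ, add_comm,
      Finset.sum_sdiff (Finset.subset_univ _), hΛ.2]

theorem isDensity_dyad {ψ : A} (hψ : ‖ψ‖ = 1) : IsDensity (dyad ψ ψ) :=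
  ⟨isPositive_dyad_self ψ, by rw [trace_dyad, ← ofReal_norm_sq_eq_inner, hψ]; simp⟩

theorem IsChannel.isDensity {N : TraceClass A →ₗ[ℂ] TraceClass B} (hN : IsChannel N)
    {ρ : TraceClass A} (hρ : IsDensity ρ) : IsDensity (N ρ) :=
  ⟨hN.completelyPositive.isPositive hρ.1, (hN.tracePreserving ρ).trans hρ.2⟩

/-- A code that transmits entanglement reliably decouples the environment from most messages. -/
theorem exists_decoupled_messages (U : A →ₗᵢ[ℂ] HTensor B E) (hM : 0 < M)
    {C : TraceClass (EuclideanSpace ℂ (Fin M)) →ₗ[ℂ] TraceClass A} (hC : IsChannel C)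
    {D : TraceClass B →ₗ[ℂ] TraceClass (EuclideanSpace ℂ (Fin M))} (hD : IsChannel D)
    {ε : ℝ} (hε₀ : 0 ≤ ε) (hε₁ : ε ≤ 1)
    (hF : ∀ φ : TraceClass (HTensor (EuclideanSpace ℂ (Fin M)) (EuclideanSpace ℂ (Fin M))),
      IsPure φ → ENNReal.ofReal (1 - ε) ≤
        fidelity φ (idTensor M (D ∘ₗ channelRight U (onb E) ∘ₗ C) φ)) :
    ∃ Λ : Fin M → B →L[ℂ] B, IsPOVM Λ ∧
      (∀ m, 1 - ε ≤ (trace (Λ m ∘L (channelRight U (onb E)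
        (C (dyad (EuclideanSpace.single m 1) (EuclideanSpace.single m 1))) : B →L[ℂ] B))).re) ∧
      ∃ ω : TraceClass E, IsDensity ω ∧ ∃ s : Finset (Fin M), M / 2 ≤ s.card ∧ ∀ m ∈ s,
        2⁻¹ * traceNorm (channelLeft U (onb B)
          (C (dyad (EuclideanSpace.single m 1) (EuclideanSpace.single m 1))) - ω : E →L[ℂ] E) ≤
          ENNReal.ofReal (2 * √ε) := by
  obtain ⟨a, ha⟩ := hC.completelyPositive.exists_encoder
  obtain ⟨g, Λ, hΛ, hg, hΛD, hgD⟩ := hD.exists_decoder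
  have hcp : IsCompletelyPositive (D ∘ₗ channelRight U (onb E) ∘ₗ C) :=
    (hD.comp ((isChannel_channelRight U (onb E)).comp hC)).completelyPositive
  have hF' : ∀ c : Fin M → ℝ, ∑ i, c i ^ 2 = 1 → 1 - ε ≤ (∑ i, ∑ j,
      ((c i ^ 2 * c j ^ 2 : ℝ) : ℂ) * ⟪EuclideanSpace.single i (1 : ℂ),
        ((D ∘ₗ channelRight U (onb E) ∘ₗ C) (dyad (EuclideanSpace.single i (1 : ℂ))
          (EuclideanSpace.single j (1 : ℂ))) : _ →L[ℂ] _)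
        (EuclideanSpace.single j (1 : ℂ))⟫_ℂ).re := fun c hc => by
    have hn : ‖diagVector c‖ = 1 := by
      have := norm_sq_diagVector c
      rw [hc] at this
      exact (pow_eq_one_iff_of_nonneg (norm_nonneg _) two_ne_zero).1 this
    have h1 := (hF (dyad (diagVector c) (diagVector c)) ⟨_, hn, rfl⟩).trans
      (fidelity_diagVector_le hcp hc)
    -- Truncation by `ENNReal.ofReal` loses the real inequality when `1 - ε ≤ 0`. Then `ε = 1`, and
    -- the sum is nonnegative by complete positivity.
    rcases le_or_gt (1 - ε) 0 with h0 | h0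
    · have hε : ε = 1 := le_antisymm hε₁ (by linarith)
      have hpos := (Complex.nonneg_iff.1 (hcp M _ (sum_inner_dyad_nonneg fun i =>
        EuclideanSpace.single i (1 : ℂ)) fun i =>
          ((c i ^ 2 : ℝ) : ℂ) • EuclideanSpace.single i (1 : ℂ))).1
      rw [hε, sub_self]
      refine hpos.trans_eq (congrArg Complex.re ?_)
      refine Finset.sum_congr rfl fun i _ => Finset.sum_congr rfl fun j _ => ?_
      rw [map_smul, inner_smul_left, inner_smul_right, Complex.conj_ofReal, ← mul_assoc,
        ← Complex.ofReal_mul]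
    · exact (ENNReal.ofReal_le_ofReal_iff'.1 h1).resolve_right (not_le.2 h0)
  refine ⟨Λ, hΛ, fun m => ?_, ?_⟩
  · rw [hΛD]
    -- The product state `|m⟩|m⟩` isolates the diagonal element, which is the probability of
    -- decoding `m` correctly.
    have := hF' (Pi.single m 1) (by simp [Pi.single_apply])
    simpa [Pi.single_apply] using this
  -- In `w p i m`, `i` is the decoder's outcome and `m` the message sent.
  · let w : basisIndex (DirectPow M A) × basisIndex (DirectPow M B) → Fin M → Fin M → E :=
      fun p i m => envVector U (g p.2 i) (a p.1 m)
    have hθ : ∀ m, IsDyadicSum (channelLeft U (onb B) (C (dyad (EuclideanSpace.single m (1 : ℂ))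
        (EuclideanSpace.single m (1 : ℂ)))) : E →L[ℂ] E) (fun q : _ × Fin M => w q.1 q.2 m)
        (fun q : _ × Fin M => w q.1 q.2 m) := fun m =>
      isDyadicSum_channelLeft (a := fun k => a k m) (g := g) U (onb B) hΛ hg (ha m m)
    have hsq : ∀ i m, Summable fun p : basisIndex (DirectPow M A) × basisIndex (DirectPow M B) =>
        ‖w p i m‖ ^ 2 := fun i m =>
      summable_prod_slice (hθ m).left i
    refine exists_common_state (w := w) hM hθ (fun m => ?_) (fun i j => hasSum_inner_envVector
        (a := fun k => a k i) (b := fun k => a k j) (g := g) U (onb E) hD hgD (ha i j) i j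
        (hsq i i) (hsq j j)) hε₀ ?_
    · exact ((isChannel_channelLeft U (onb B)).isDensity
        (hC.isDensity (isDensity_dyad (by simp)))).2
    · have hM' : (0 : ℝ) < M := by exact_mod_cast hM
      -- The maximally entangled state: all weights `cᵢ²cⱼ²` equal `M⁻²`.
      have h1 := hF' (fun _ => (√M)⁻¹) (by
        simp only [inv_pow, Real.sq_sqrt hM'.le, Finset.sum_const, Finset.card_univ,
          Fintype.card_fin, nsmul_eq_mul]
        exact mul_inv_cancel₀ hM'.ne')
      simp only [inv_pow, Real.sq_sqrt hM'.le, ← Finset.mul_sum] at h1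
      rw [Complex.re_ofReal_mul, ← mul_inv, ← sq, inv_mul_eq_div,
        le_div_iff₀ (by positivity)] at h1
      rw [mul_comm]
      exact h1

end Conversion

end QInfo

end

/-! ### Assembly of the private code. -/

theorem mainTheorem8 {A B E ι : Type*}
    [NormedAddCommGroup A] [InnerProductSpace ℂ A] [CompleteSpace A]
    [TopologicalSpace.SeparableSpace A]
    [NormedAddCommGroup B] [InnerProductSpace ℂ B] [CompleteSpace B]
    [TopologicalSpace.SeparableSpace B]
    [NormedAddCommGroup E] [InnerProductSpace ℂ E] [CompleteSpace E]
    [TopologicalSpace.SeparableSpace E]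
    (N : QInfo.TraceClass A →ₗ[ℂ] QInfo.TraceClass B) (hN : QInfo.IsChannel N)
    (N' : QInfo.TraceClass A →ₗ[ℂ] QInfo.TraceClass E) (hN' : QInfo.IsComplementary N N')
    (G : QInfo.EnergyObservable ι A) (n M : ℕ) (hn : 1 ≤ n) (hM : 2 ≤ M)
    (P ε : ℝ) (hP : 0 ≤ P) (hε₀ : 0 ≤ ε) (hε₁ : ε ≤ 1) :
    Nonempty (QInfo.QuantumCode N G n M P ε) →
      Nonempty (QInfo.PrivateCode N N' G n (M / 2) P (2 * Real.sqrt ε)) := by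
  rintro ⟨code⟩
  obtain ⟨U, hU, hU'⟩ := hN'.exists_isometry_tensorPower n
  have hF := code.fidelity_ge
  rw [hU] at hF
  obtain ⟨Λ, hΛ, hdec, ω, hω, s, hs, hsec⟩ := QInfo.exists_decoupled_messages U (by omega)
    code.enc_isChannel code.dec_isChannel hε₀ hε₁ hF
  have hdens : ∀ m, QInfo.IsDensity (code.enc (QInfo.dyad (EuclideanSpace.single m (1 : ℂ))
      (EuclideanSpace.single m (1 : ℂ)))) := fun m =>
    code.enc_isChannel.isDensity (QInfo.isDensity_dyad (by simp))
  -- Exactly `M / 2` of the decoupled messages are kept.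
  let σ : Fin (M / 2) ↪ Fin M := (s.orderEmbOfCardLe hs).toEmbedding
  -- Decoding succeeds with error `ε`; this weakens it to the common parameter of the private code.
  have hε : ε ≤ 2 * Real.sqrt ε := by
    have h1 : ε ≤ Real.sqrt ε := Real.le_sqrt_of_sq_le (by nlinarith)
    linarith [Real.sqrt_nonneg ε]
  exact ⟨{
    codeword := fun m => code.enc (QInfo.dyad (EuclideanSpace.single (σ m) (1 : ℂ))
      (EuclideanSpace.single (σ m) (1 : ℂ)))
    povm := QInfo.restrictPOVM σ Λ
    envState := ω
    codeword_isDensity := fun m => hdens _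
    -- `M ≥ 2` guarantees a zeroth message to absorb the discarded outcomes.
    povm_isPOVM := QInfo.isPOVM_restrictPOVM (by omega) σ hΛ
    envState_isDensity := hω
    energy_le := fun m => code.energy_le _ (QInfo.isDensity_dyad (by simp))
    decoding := fun m => by
      rw [hU]
      have h1 := QInfo.trace_comp_mono
        ((QInfo.isChannel_channelRight U (QInfo.onb (QInfo.TPow n E))).isDensity (hdens (σ m))).1
        (QInfo.isPositive_restrictPOVM_sub σ hΛ m)
      linarith [hdec (σ m)]
    security := fun m => by
      rw [hU']
      exact hsec _ (s.orderEmbOfCardLe_mem hs m) }⟩
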